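/- Let $m,n\ge 2$ be integers, and let $\mathbb M=\mathbb M^{m\times n}$ be the space of real $m\times n$ matrices. Let $L\in\mathbb M\setminus\{0\}$ and $t\in\mathbb R$, and put $\Sigma_t=\{\xi\in\mathbb M : \sum_{i,j}L_{ij}\xi_{ij}=t\}$. **Definitions.** For a set $O$ that is open in $\mathbb M$ or relatively open in $\Sigma_t$, a function $f:O\to\mathbb R$ is *rank-one convex* if $f(\lambda\xi_1+(1-\lambda)\xi_2)\le\lambda f(\xi_1)+(1-\lambda)f(\xi_2)$ for all $\lambda\in[0,1]$ and all $\xi_1,\xi_2\in O$ with $[\xi_1,\xi_2]\subset O$ and $\operatorname{rank}(\xi_1-\xi_2)=1$. For a compact set $K\subset\mathbb M$ let $$K^{rc}=\{\xi\in\mathbb M : f(\xi)\le \sup_K f\ \text{ for every rank-one convex } f:\mathbb M\to\mathbb R\}$$ (with $\sup_\emptyset f=-\infty$). For a compact set $K\subset\Sigma_t$ let $K^{rc,\Sigma_t}$ be the set of all $\xi\in\Sigma_t$ for which there is no rank-one convex $f:\Sigma_t\to\mathbb R$ with $f\le 0$ on $K$ and $f(\xi)>0$. Let $\mathcal P$ be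 the set of Borel probability measures on $\mathbb M$ with compact support. For $\nu\in\mathcal P$ let $\bar\nu=\int\xi\,d\nu(\xi)$ be its barycentre. A measure $\nu\in\mathcal P$ is a *laminate* if $\int f\,d\nu\ge f(\bar\nu)$ for every rank-one convex $f:\mathbb M\to\mathbb R$. For compact $K$, $\mathcal M^{rc}(K)$ is the set of laminates $\nu$ with $\operatorname{supp}\nu\subset K$. For $\mathcal O$ relatively open in $\Sigma_t$, the class $\mathfrak L(\mathcal O)$ of *laminates of finite order in* $\mathcal O$ is defined inductively: * (i) for each $\xi\in\mathcal O$, the Dirac mass $\delta_\xi$ is a laminate of order $0$ in $\mathcal O$; * (ii) suppose that $k\ge1$, that $\xi_1,\dots,\xi_k\in\mathcal O$ are pairwise distinct, that $\lambda_1,\dots,\lambda_k>0$ with $\sum_{j=1}^k\lambda_j=1$, and that $\sum_{j=1}^k\lambda_j\delta_{\xi_j}$ is a laminate of order $k-1$ in $\mathcal O$. Suppose further that $\xi_k=s\eta_1+(1-s)\eta_2$ with $0<s<1$, $\operatorname{rank}(\eta_1-\eta_2)=1$, $[\eta_1,\eta_2]\subset\mathcal O$, and $\eta_1,\eta_2\notin\{\xi_1,\dots,\xi_{k-1}\}$.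 Then $\sum_{j=1}^{k-1}\lambda_j\delta_{\xi_j}+s\lambda_k\delta_{\eta_1}+(1-s)\lambda_k\delta_{\eta_2}$ is a laminate of order $k$ in $\mathcal O$. **Theorem.** Let $K$ be a compact subset of $\Sigma_t$. Then $K^{rc}=K^{rc,\Sigma_t}$. Moreover, for every $\nu\in\mathcal M^{rc}(K)$ and every relatively open set $\mathcal O\subset\Sigma_t$ containing $K^{rc}$, there is a sequence $(\nu_j)$ in $\mathfrak L(\mathcal O)$ with $\bar\nu_j=\bar\nu$ for all $j$ that converges weakly* to $\nu$, that is, $\int f\,d\nu_j\to\int f\,d\nu$ for every continuous function $f:\mathbb M\to\mathbb R$. -/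

import Mathlib

open MeasureTheory

namespace RankOneHull

/-- The space of real `m × n` matrices (with its usual topology). -/
abbrev Mat (m n : ℕ) : Type := Matrix (Fin m) (Fin n) ℝ

/-- Matrices carry their Borel σ-algebra. -/
instance instMeasurableSpaceMat (m n : ℕ) : MeasurableSpace (Mat m n) := borel (Mat m n)

instance instBorelSpaceMat (m n : ℕ) : BorelSpace (Mat m n) := ⟨rfl⟩

/-- The linear function `ξ ↦ L · ξ = ∑ i j, L i j * ξ i j`. -/
def linFun {m n : ℕ} (L ξ : Mat m n) : ℝ := ∑ i, ∑ j, L i j * ξ i j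

/-- The affine hyperplane `Σ_t = {ξ | L · ξ = t}`. -/
def hyperplane {m n : ℕ} (L : Mat m n) (t : ℝ) : Set (Mat m n) := {ξ | linFun L ξ = t}

/-- `O` is a (relatively) open subset of `S`. -/
def IsOpenIn {X : Type*} [TopologicalSpace X] (S O : Set X) : Prop :=
  ∃ V : Set X, IsOpen V ∧ O = V ∩ S

/-- `f` is rank-one convex on `O`. Only the values of `f` on `O` matter, so this expresses rank-one
convexity of functions `O → ℝ`. -/
def RankOneConvexOn {m n : ℕ} (O : Set (Mat m n)) (f : Mat m n → ℝ) : Prop :=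
  ∀ ξ₁ ∈ O, ∀ ξ₂ ∈ O, segment ℝ ξ₁ ξ₂ ⊆ O → (ξ₁ - ξ₂).rank = 1 →
    ∀ r ∈ Set.Icc (0 : ℝ) 1, f (r • ξ₁ + (1 - r) • ξ₂) ≤ r * f ξ₁ + (1 - r) * f ξ₂

/-- The rank-one convex hull `K^{rc}` of a compact set `K`: all `ξ` with `f ξ ≤ sup_K f` for every
rank-one convex `f` on the whole matrix space. The supremum is taken in `[-∞, ∞]`. -/
def rcHull {m n : ℕ} (K : Set (Mat m n)) : Set (Mat m n) :=
  {ξ | ∀ f : Mat m n → ℝ, RankOneConvexOn Set.univ f → (f ξ : EReal) ≤ ⨆ η ∈ K, (f η : EReal)}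

/-- The rank-one convex hull of a compact set `K ⊆ S` relative to `S`: a point `ξ` of `S` fails to
lie in it iff `f ξ > 0` for some rank-one convex `f : S → ℝ` with `f ≤ 0` on `K`. -/
def rcHullIn {m n : ℕ} (S K : Set (Mat m n)) : Set (Mat m n) :=
  {ξ | ξ ∈ S ∧ ¬ ∃ f : Mat m n → ℝ, RankOneConvexOn S f ∧ (∀ η ∈ K, f η ≤ 0) ∧ 0 < f ξ}

/-- The set `𝒫` of Borel probability measures with compact support. -/
def compactProb (m n : ℕ) : Set (Measure (Mat m n)) :=
  {ν | IsProbabilityMeasure ν ∧ IsCompact ν.support}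

/-- The center of mass `∫ ξ dν(ξ)`, computed entry by entry. -/
noncomputable def barycenter {m n : ℕ} (ν : Measure (Mat m n)) : Mat m n :=
  Matrix.of fun i j => ∫ ξ, ξ i j ∂ν

/-- Laminates: compactly supported probability measures that satisfy Jensen's inequality for all
rank-one convex functions on the whole matrix space. -/
def IsLaminate {m n : ℕ} (ν : Measure (Mat m n)) : Prop :=
  ν ∈ compactProb m n ∧
    ∀ f : Mat m n → ℝ, RankOneConvexOn Set.univ f → f (barycenter ν) ≤ ∫ ξ, f ξ ∂ν

/-- The set `ℳ^{rc}(K)` of laminates supported in `K`. -/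
def laminatesOn {m n : ℕ} (K : Set (Mat m n)) : Set (Measure (Mat m n)) :=
  {ν | ν.support ⊆ K ∧ IsLaminate ν}

/-- The discrete measure `∑ j, w j • δ_{ξ j}`. -/
noncomputable def discrete {m n p : ℕ} (w : Fin p → ℝ) (ξ : Fin p → Mat m n) :
    Measure (Mat m n) :=
  ∑ j, ENNReal.ofReal (w j) • Measure.dirac (ξ j)

/-- Laminates of finite order in `O`, with their order. A laminate of order `p + 1` arises from a
laminate of order `p`, having `p + 1` distinct atoms in `O`, by splitting one atom (listed last)
along a rank-one segment contained in `O`, the new atoms being different from the other old ones. -/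
inductive IsLaminateOfOrder {m n : ℕ} (O : Set (Mat m n)) : ℕ → Measure (Mat m n) → Prop
  | dirac (ξ : Mat m n) (hξ : ξ ∈ O) : IsLaminateOfOrder O 0 (Measure.dirac ξ)
  | split (p : ℕ) (w : Fin (p + 1) → ℝ) (ξ : Fin (p + 1) → Mat m n)
      (hw : ∀ j, 0 < w j) (hsum : ∑ j, w j = 1)
      (hξ : ∀ j, ξ j ∈ O) (hinj : Function.Injective ξ)
      (hlam : IsLaminateOfOrder O p (discrete w ξ))
      (s : ℝ) (hs₀ : 0 < s) (hs₁ : s < 1) (η₁ η₂ : Mat m n)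
      (hseg : segment ℝ η₁ η₂ ⊆ O) (hrank : (η₁ - η₂).rank = 1)
      (hsplit : ξ (Fin.last p) = s • η₁ + (1 - s) • η₂)
      (hη₁ : ∀ j : Fin p, η₁ ≠ ξ j.castSucc) (hη₂ : ∀ j : Fin p, η₂ ≠ ξ j.castSucc) :
      IsLaminateOfOrder O (p + 1)
        (discrete (fun j : Fin p => w j.castSucc) (fun j : Fin p => ξ j.castSucc)
          + ENNReal.ofReal (s * w (Fin.last p)) • Measure.dirac η₁
          + ENNReal.ofReal ((1 - s) * w (Fin.last p)) • Measure.dirac η₂)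

/-- The class `𝔏(O)` of laminates of finite order in `O`. -/
def finiteLaminates {m n : ℕ} (O : Set (Mat m n)) : Set (Measure (Mat m n)) :=
  {ν | ∃ k, IsLaminateOfOrder O k ν}

end RankOneHull

/-! Write `ℓ ξ = L · ξ`. Since `ℓ - t` and `t - ℓ` are rank-one convex, the hull of `K` stays in
`Σ_t`. The substance is an extension theorem (`DirConvexOn.exists_extension`): a rank-one convex
function `f` on a relatively open subset of `Σ_t` containing the hull is, uniformly on the hull, a
limit of functions that are rank-one convex on the whole space.

Extension. Tangent rank-one matrices span `ker ℓ`, so `f` is continuous. Composing `f` with an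
affine projection onto `Σ_t` and mollifying gives a smooth `G` whose Hessian is nonnegative, near
the hull, on tangent rank-one directions. A small multiple of the squared Euclidean norm makes it
positive there; by compactness of the set of unit rank-one matrices, a large multiple of `(ℓ - t)²`
then handles all rank-one directions, and this term vanishes on `Σ_t`. The result is rank-one convex
near the hull only. Taking its maximum with a globally rank-one convex function that is nonpositive
on the hull and large on the boundary of a neighbourhood makes it global without changing it on the
hull, up to constants.

Equality of the hulls follows by extending a separating function. For the density of laminates of
finite order, Hahn–Banach would otherwise provide a continuous `g` with `∫ g dν` below all averages
of `g` over finite splittings of the barycentre. The infimum of these averages, as a function of the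
starting point, is rank-one convex and at most `g`; extending it contradicts Jensen's inequality for
`ν`. Finally, the splittings are perturbed so that no two atoms coincide.

Everything is done for a cone `D` of directions, later the rank-one matrices. -/

namespace RankOneHull

open Set Filter Topology

/-! ### Continuity of separately convex functions -/

section SeparatelyConvex

variable {ι : Type*} [DecidableEq ι]

/-- `f` is convex in each variable separately on the cube `[-r, r]^ι`. -/
def SeparatelyConvexOnCube (r : ℝ) (f : (ι → ℝ) → ℝ) : Prop :=
  ∀ x : ι → ℝ, (∀ j, |x j| ≤ r) → ∀ i,
    ConvexOn ℝ (Icc (-r) r) (fun s => f (Function.update x i s))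

theorem abs_update_le {r : ℝ} {x : ι → ℝ} (hx : ∀ j, |x j| ≤ r) {i : ι} {s : ℝ} (hs : |s| ≤ r) :
    ∀ j, |Function.update x i s j| ≤ r := by
  intro j
  by_cases h : j = i
  · subst h; simpa using hs
  · simpa [h] using hx j

variable [Fintype ι]

/-- Pushing one coordinate at a time to an end of its interval bounds `f` by its maximum over the
vertices. -/
theorem SeparatelyConvexOnCube.exists_le {r : ℝ} {f : (ι → ℝ) → ℝ} (hr : 0 < r)
    (hf : SeparatelyConvexOnCube r f) : ∃ M, ∀ x : ι → ℝ, (∀ j, |x j| ≤ r) → f x ≤ M := by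
  have hfin : ({x : ι → ℝ | ∀ j, x j ∈ ({r, -r} : Set ℝ)}).Finite :=
    Set.Finite.pi' fun _ => Set.toFinite _
  obtain ⟨M, hM⟩ := (hfin.image f).bddAbove
  refine ⟨M, ?_⟩
  have key : ∀ S : Finset ι, ∀ x : ι → ℝ, (∀ j, |x j| ≤ r) →
      (∀ j, j ∉ S → x j ∈ ({r, -r} : Set ℝ)) → f x ≤ M := by
    intro S
    induction S using Finset.induction_on with
    | empty => exact fun x _ h => hM ⟨x, fun j => h j (by simp), rfl⟩
    | insert i S hi ih =>
      intro x hx h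
      have hmem : ∀ s : ℝ, s ∈ ({r, -r} : Set ℝ) → f (Function.update x i s) ≤ M := by
        intro s hs
        have hs' : |s| ≤ r := by
          rcases hs with rfl | hs
          · exact (abs_of_pos hr).le
          · rw [mem_singleton_iff.1 hs, abs_neg, abs_of_pos hr]
        refine ih _ (abs_update_le hx hs') fun j hj => ?_
        by_cases hji : j = i
        · subst hji; simpa using hs
        · simpa [hji] using h j (by simp [hji, hj])
      have := (hf x hx i).le_max_of_mem_Icc (x := -r) (y := r) (z := x i)
        (by simp [hr.le]) (by simp [hr.le]) (abs_le.1 (hx i))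
      simp only [Function.update_eq_self] at this
      exact this.trans (max_le (hmem _ (by simp)) (hmem _ (by simp)))
  exact fun x hx => key Finset.univ x hx (by simp)

/-- The value at `x i = 0` is at most the mean of the values at `x i` and `-x i`, and the latter is
at most `M`; hence each freed coordinate turns a lower bound `m` into `2 * m - M`. -/
theorem SeparatelyConvexOnCube.exists_ge {r : ℝ} {f : (ι → ℝ) → ℝ} (hr : 0 < r)
    (hf : SeparatelyConvexOnCube r f) : ∃ M, ∀ x : ι → ℝ, (∀ j, |x j| ≤ r) → M ≤ f x := by
  obtain ⟨M, hM⟩ := hf.exists_le hr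
  have key : ∀ S : Finset ι, ∃ m, ∀ x : ι → ℝ, (∀ j, |x j| ≤ r) →
      (∀ j, j ∉ S → x j = 0) → m ≤ f x := by
    intro S
    induction S using Finset.induction_on with
    | empty =>
      refine ⟨f 0, fun x _ h => ?_⟩
      rw [show x = 0 from funext fun j => h j (by simp)]
    | insert i S hi ih =>
      obtain ⟨m, hm⟩ := ih
      refine ⟨2 * m - M, fun x hx h => ?_⟩
      have h0 : m ≤ f (Function.update x i 0) := by
        refine hm _ (abs_update_le hx (by simpa using hr.le)) fun j hj => ?_
        by_cases hji : j = i
        · subst hji; simp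
        · simpa [hji] using h j (by simp [hji, hj])
      have h1 : f (Function.update x i (-x i)) ≤ M :=
        hM _ (abs_update_le hx (by simpa using hx i))
      have hxi := abs_le.1 (hx i)
      have h2 := (hf x hx i).2 hxi
        (show -x i ∈ Icc (-r) r from ⟨by linarith [hxi.2], by linarith [hxi.1]⟩)
        (show (0 : ℝ) ≤ 1 / 2 by norm_num) (show (0 : ℝ) ≤ 1 / 2 by norm_num) (by norm_num)
      simp only [smul_eq_mul, mul_neg, add_neg_cancel, Function.update_eq_self] at h2
      linarith
  obtain ⟨m, hm⟩ := key Finset.univ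
  exact ⟨m, fun x hx => hm x hx (by simp)⟩

/-- A bounded convex function of one variable is Lipschitz away from the ends, with a constant
independent of the other coordinates. Setting the coordinates to zero one by one and adding up gives
the estimate. -/
theorem SeparatelyConvexOnCube.continuousAt_zero {r : ℝ} {f : (ι → ℝ) → ℝ} (hr : 0 < r)
    (hf : SeparatelyConvexOnCube r f) : ContinuousAt f 0 := by
  obtain ⟨M, hM⟩ := hf.exists_le hr
  obtain ⟨m, hm⟩ := hf.exists_ge hr
  set B := max |M| |m|
  have hB : ∀ x : ι → ℝ, (∀ j, |x j| ≤ r) → |f x| ≤ B := fun x hx =>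
    abs_le.2 ⟨by linarith [neg_abs_le m, le_max_right |M| |m|, hm x hx],
      by linarith [le_abs_self M, le_max_left |M| |m|, hM x hx]⟩
  set C : ℝ := ((2 * B / (r / 2)).toNNReal : ℝ)
  have key : ∀ S : Finset ι, ∀ x : ι → ℝ, (∀ j, |x j| < r / 2) → (∀ j, j ∉ S → x j = 0) →
      |f x - f 0| ≤ ∑ j ∈ S, C * |x j| := by
    intro S
    induction S using Finset.induction_on with
    | empty =>
      intro x _ h
      rw [show x = 0 from funext fun j => h j (by simp)]
      simp
    | insert i S hi ih =>
      intro x hx h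
      have hx' : ∀ j, |x j| ≤ r := fun j => by linarith [hx j]
      have hconv : ConvexOn ℝ (Metric.ball (0 : ℝ) r) (fun s => f (Function.update x i s)) := by
        refine (hf x hx' i).subset ?_ (convex_ball _ _)
        intro s hs
        rw [mem_ball_zero_iff, Real.norm_eq_abs] at hs
        exact abs_le.1 hs.le
      have hl := hconv.lipschitzOnWith_of_abs_le (ε := r / 2) (M := B) (by positivity)
        (fun a ha => hB _ (abs_update_le hx' (by simpa using ha.le)))
      have h1 := hl.dist_le_mul (x i) (by simpa using by linarith [hx i]) 0
        (by simpa using by linarith)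
      simp only [Function.update_eq_self, Real.dist_eq, sub_zero] at h1
      have h2 := ih (Function.update x i 0) (by
        intro j
        by_cases hji : j = i
        · subst hji; simpa using hr
        · simpa [hji] using hx j) (by
        intro j hj
        by_cases hji : j = i
        · subst hji; simp
        · simpa [hji] using h j (by simp [hji, hj]))
      rw [Finset.sum_insert hi]
      have h3 : ∑ j ∈ S, C * |Function.update x i 0 j| = ∑ j ∈ S, C * |x j| := by
        refine Finset.sum_congr rfl fun j hj => ?_
        have : j ≠ i := by rintro rfl; exact hi hj
        simp [this]
      rw [h3] at h2
      calc |f x - f 0| ≤ |f x - f (Function.update x i 0)| + |f (Function.update x i 0) - f 0| :=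
            abs_sub_le _ _ _
        _ ≤ _ := add_le_add h1 h2
  have hlim : Tendsto (fun x : ι → ℝ => ∑ j, C * |x j|) (𝓝 0) (𝓝 0) := by
    have : Continuous fun x : ι → ℝ => ∑ j, C * |x j| := by fun_prop
    simpa using this.tendsto 0
  rw [ContinuousAt, tendsto_iff_dist_tendsto_zero]
  refine squeeze_zero' (Eventually.of_forall fun _ => dist_nonneg) ?_ hlim
  have hn : ∀ᶠ x : ι → ℝ in 𝓝 0, ∀ j, |x j| < r / 2 := by
    rw [eventually_all]
    intro j
    have : Continuous fun x : ι → ℝ => |x j| := by fun_prop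
    exact this.tendsto 0 |>.eventually (gt_mem_nhds (by simpa using hr))
  filter_upwards [hn] with x hx
  exact key Finset.univ x hx (by simp)

end SeparatelyConvex

/-! ### Functions convex along a cone of directions -/

section DirConvex

/-- `f` is convex along all segments in `O` whose direction belongs to `D`. -/
def DirConvexOn {V : Type*} [AddCommGroup V] [Module ℝ V] (D O : Set V) (f : V → ℝ) : Prop :=
  ∀ x ∈ O, ∀ y ∈ O, segment ℝ x y ⊆ O → x - y ∈ D →
    ∀ r ∈ Icc (0 : ℝ) 1, f (r • x + (1 - r) • y) ≤ r * f x + (1 - r) * f y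

variable {V : Type*} [AddCommGroup V] [Module ℝ V] {D O : Set V} {f g : V → ℝ}

theorem DirConvexOn.mono {O' : Set V} (hf : DirConvexOn D O f) (h : O' ⊆ O) :
    DirConvexOn D O' f :=
  fun x hx y hy hs => hf x (h hx) y (h hy) (hs.trans h)

theorem DirConvexOn.add_const (hf : DirConvexOn D O f) (c : ℝ) :
    DirConvexOn D O fun x => f x + c := by
  intro x hx y hy hs hd r hr
  have := hf x hx y hy hs hd r hr
  dsimp only
  linarith

theorem DirConvexOn.const_mul (hf : DirConvexOn D O f) {c : ℝ} (hc : 0 ≤ c) :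
    DirConvexOn D O fun x => c * f x := by
  intro x hx y hy hs hd r hr
  have := mul_le_mul_of_nonneg_left (hf x hx y hy hs hd r hr) hc
  dsimp only
  linarith

theorem DirConvexOn.sup (hf : DirConvexOn D O f) (hg : DirConvexOn D O g) :
    DirConvexOn D O fun x => max (f x) (g x) := by
  intro x hx y hy hs hd r hr
  have h0 : 0 ≤ 1 - r := by linarith [hr.2]
  refine max_le ((hf x hx y hy hs hd r hr).trans ?_) ((hg x hx y hy hs hd r hr).trans ?_)
  · exact add_le_add (mul_le_mul_of_nonneg_left (le_max_left _ _) hr.1)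
      (mul_le_mul_of_nonneg_left (le_max_left _ _) h0)
  · exact add_le_add (mul_le_mul_of_nonneg_left (le_max_right _ _) hr.1)
      (mul_le_mul_of_nonneg_left (le_max_right _ _) h0)

theorem dirConvexOn_of_convexOn (hf : ConvexOn ℝ univ f) : DirConvexOn D O f := by
  intro x _ y _ _ _ r hr
  exact hf.2 (mem_univ x) (mem_univ y) hr.1 (by linarith [hr.2]) (by ring)

/-- Convexity of `f` along a line with direction in `D`, as a function of the parameter. -/
theorem DirConvexOn.convexOn_line (hD : ∀ η ∈ D, ∀ c : ℝ, c ≠ 0 → c • η ∈ D)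
    (hf : DirConvexOn D O f) {x η : V} (hη : η ∈ D) {I : Set ℝ} (hI : Convex ℝ I)
    (hO : ∀ s ∈ I, x + s • η ∈ O) : ConvexOn ℝ I fun s => f (x + s • η) := by
  refine ⟨hI, fun a ha b hb p q hp hq hpq => ?_⟩
  -- The degenerate segment is separate: `D` is only assumed stable under nonzero scalars.
  rcases eq_or_ne a b with rfl | hab
  · simp only [smul_eq_mul, ← add_mul, hpq, one_mul]
    exact le_rfl
  obtain rfl : q = 1 - p := by linarith
  have hcomb : ∀ p q : ℝ, p + q = 1 →
      p • (x + a • η) + q • (x + b • η) = x + (p • a + q • b) • η := by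
    intro p q h
    obtain rfl : q = 1 - p := by linarith
    simp only [smul_eq_mul]
    module
  have h := hf (x + a • η) (hO a ha) (x + b • η) (hO b hb) (by
    rintro _ ⟨p, q, hp, hq, hpq, rfl⟩
    rw [hcomb p q hpq]
    exact hO _ (hI ha hb hp hq hpq)) (by
    rw [show x + a • η - (x + b • η) = (a - b) • η by module]
    exact hD η hη _ (sub_ne_zero.2 hab)) p ⟨hp, by linarith⟩
  rw [hcomb p (1 - p) (by ring)] at h
  exact h

end DirConvex

/-! ### Continuity of directionally convex functions -/

section Continuity

variable {V : Type*} [NormedAddCommGroup V] [NormedSpace ℝ V] [FiniteDimensional ℝ V]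
  {D : Set V} {f : V → ℝ}

/-- A function that is convex in the directions `D` is continuous on relatively open subsets of an
affine subspace whose direction is spanned by elements of `D`. -/
theorem DirConvexOn.continuousOn (hD : ∀ η ∈ D, ∀ c : ℝ, c ≠ 0 → c • η ∈ D) {W : Submodule ℝ V}
    (hW : W ≤ Submodule.span ℝ (D ∩ W)) {S O U : Set V} (hS : ∀ x ∈ S, ∀ y, y ∈ S ↔ y - x ∈ W)
    (hU : IsOpen U) (hO : O = U ∩ S) (hf : DirConvexOn D O f) : ContinuousOn f O := by
  classical
  subst hO
  intro x hx
  -- A basis of `W` made of elements of `D`: in its coordinates, convexity along `D` yields separate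
  -- convexity.
  obtain ⟨b, hbs, hspan, hli⟩ := exists_linearIndependent ℝ (D ∩ (W : Set V))
  have hfinb : Finite b := hli.finite
  have := Fintype.ofFinite b
  let Φ : (b → ℝ) →ₗ[ℝ] V := Fintype.linearCombination ℝ (fun i : b => (i : V))
  have hΦ : ∀ y, Φ y = ∑ i, y i • (i : V) := fun y => by
    simp [Φ, Fintype.linearCombination_apply]
  have hker : LinearMap.ker Φ = ⊥ := by
    rw [LinearMap.ker_eq_bot']
    intro y hy
    rw [hΦ] at hy
    exact funext fun i => Fintype.linearIndependent_iff.1 hli y hy i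
  obtain ⟨ψ, hψ⟩ := Φ.exists_leftInverse_of_injective hker
  have hrange : ∀ w ∈ W, Φ (ψ w) = w := by
    intro w hw
    have hw' : w ∈ Submodule.span ℝ (Set.range (fun i : b => (i : V))) := by
      rw [Subtype.range_coe, hspan]; exact hW hw
    obtain ⟨c, hc⟩ := (Submodule.mem_span_range_iff_exists_fun ℝ).1 hw'
    have : Φ c = w := by rw [hΦ]; exact hc
    rw [← this]
    exact congrArg Φ (LinearMap.congr_fun hψ c)
  have hΦW : ∀ y, Φ y ∈ W := fun y => by
    rw [hΦ]
    exact Submodule.sum_mem _ fun i _ => W.smul_mem _ (hbs i.2).2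
  have hΦc : Continuous Φ := Φ.continuous_of_finiteDimensional
  have hψc : Continuous ψ := ψ.continuous_of_finiteDimensional
  have hopen : (fun y => x + Φ y) ⁻¹' U ∈ 𝓝 (0 : b → ℝ) := by
    refine (hU.preimage (by fun_prop)).mem_nhds ?_
    simpa using hx.1
  obtain ⟨r, hr, hball⟩ := Metric.mem_nhds_iff.1 hopen
  have hcube : ∀ y : b → ℝ, (∀ j, |y j| ≤ r / 2) → x + Φ y ∈ U ∩ S := by
    intro y hy
    refine ⟨hball ?_, (hS x hx.2 _).2 (by simpa using hΦW y)⟩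
    rw [mem_ball_zero_iff]
    refine lt_of_le_of_lt ((pi_norm_le_iff_of_nonneg (by positivity)).2 hy) (by linarith)
  have hsep : SeparatelyConvexOnCube (r / 2) (fun y => f (x + Φ y)) := by
    intro y hy i
    have hline : ∀ s : ℝ, x + Φ (Function.update y i s)
        = (x + Φ (Function.update y i 0)) + s • (i : V) := by
      intro s
      have : Function.update y i s = Function.update y i 0 + s • Pi.single i (1 : ℝ) := by
        ext j
        by_cases hji : j = i
        · subst hji; simp
        · simp [hji]
      rw [this, map_add, map_smul, ← add_assoc]
      congr 2
      rw [hΦ]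
      simp [Pi.single_apply]
    have := hf.convexOn_line hD (x := x + Φ (Function.update y i 0)) (η := (i : V)) (hbs i.2).1
      (convex_Icc (-(r / 2)) (r / 2)) (fun s hs => by
        rw [← hline]
        exact hcube _ (abs_update_le hy (abs_le.2 hs)))
    refine this.congr fun s _ => ?_
    simp only [hline s]
  have hc0 := hsep.continuousAt_zero (by positivity)
  have hcomp : ContinuousAt (fun z => f (x + Φ (ψ (z - x)))) x := by
    have h1 : ContinuousAt (fun z => ψ (z - x)) x := by fun_prop
    have h2 : ψ (x - x) = 0 := by simp
    exact ContinuousAt.comp (g := fun y => f (x + Φ y)) (by rw [h2]; exact hc0) h1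
  refine (hcomp.continuousWithinAt (s := U ∩ S)).congr (fun z hz => ?_) ?_
  · rw [hrange _ ((hS x hx.2 z).1 hz.2)]; simp
  · simp

theorem DirConvexOn.continuous (hD : ∀ η ∈ D, ∀ c : ℝ, c ≠ 0 → c • η ∈ D)
    (hspan : Submodule.span ℝ D = ⊤) (hf : DirConvexOn D univ f) : Continuous f := by
  rw [← continuousOn_univ]
  exact hf.continuousOn hD (W := ⊤) (S := univ) (U := univ) (by simp [hspan]) (by simp)
    isOpen_univ (by simp)

end Continuity

/-! ### The hull and globalization of functions defined near it -/

section Hull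

/-- The hull of `K` with respect to the functions on `V` that are convex in the directions `D`. -/
def dirHull {V : Type*} [AddCommGroup V] [Module ℝ V] (D K : Set V) : Set V :=
  {ξ | ∀ f : V → ℝ, DirConvexOn D univ f → (∀ η ∈ K, f η ≤ 0) → f ξ ≤ 0}

theorem subset_dirHull {V : Type*} [AddCommGroup V] [Module ℝ V] (D K : Set V) :
    K ⊆ dirHull D K := fun _ hξ _ _ h => h _ hξ

variable {V : Type*} [NormedAddCommGroup V] [NormedSpace ℝ V] [FiniteDimensional ℝ V]
  {D K : Set V}

/-- The hull is an intersection of sublevel sets of continuous functions, and the convex function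
`‖x‖ - R` keeps it in the ball of radius `R`. -/
theorem isCompact_dirHull (hD : ∀ η ∈ D, ∀ c : ℝ, c ≠ 0 → c • η ∈ D)
    (hspan : Submodule.span ℝ D = ⊤) (hK : IsCompact K) : IsCompact (dirHull D K) := by
  have := FiniteDimensional.proper ℝ V
  refine Metric.isCompact_of_isClosed_isBounded ?_ ?_
  · have : dirHull D K = ⋂ (f : V → ℝ) (_ : DirConvexOn D univ f) (_ : ∀ η ∈ K, f η ≤ 0),
        {ξ | f ξ ≤ 0} := by
      ext ξ; simp [dirHull]
    rw [this]
    refine isClosed_iInter fun f => isClosed_iInter fun hf => isClosed_iInter fun _ => ?_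
    exact isClosed_le (hf.continuous hD hspan) continuous_const
  · obtain ⟨R, hR⟩ := hK.isBounded.exists_norm_le
    refine isBounded_iff_forall_norm_le.2 ⟨R, fun ξ hξ => ?_⟩
    have h := hξ (fun x => ‖x‖ + -R) ((dirConvexOn_of_convexOn convexOn_univ_norm).add_const _)
      (fun η hη => by simpa using hR η hη)
    linarith

/-- A compact set disjoint from the hull is separated from it by a single function. -/
theorem exists_pos_of_disjoint_dirHull (hD : ∀ η ∈ D, ∀ c : ℝ, c ≠ 0 → c • η ∈ D)
    (hspan : Submodule.span ℝ D = ⊤) {C : Set V} (hC : IsCompact C)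
    (hdisj : ∀ x ∈ C, x ∉ dirHull D K) :
    ∃ g : V → ℝ, DirConvexOn D univ g ∧ (∀ η ∈ K, g η ≤ 0) ∧ ∀ x ∈ C, 0 < g x := by
  refine hC.induction_on
    (p := fun C => ∃ g : V → ℝ, DirConvexOn D univ g ∧ (∀ η ∈ K, g η ≤ 0) ∧ ∀ x ∈ C, 0 < g x)
    ?_ ?_ ?_ ?_
  · refine ⟨fun _ => 0, dirConvexOn_of_convexOn (convexOn_const 0 convex_univ), by simp, by simp⟩
  · rintro s t hst ⟨g, h1, h2, h3⟩
    exact ⟨g, h1, h2, fun x hx => h3 x (hst hx)⟩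
  · rintro s t ⟨g, h1, h2, h3⟩ ⟨g', h1', h2', h3'⟩
    refine ⟨fun x => max (g x) (g' x), h1.sup h1', fun η hη => max_le (h2 η hη) (h2' η hη), ?_⟩
    rintro x (hx | hx)
    · exact lt_max_of_lt_left (h3 x hx)
    · exact lt_max_of_lt_right (h3' x hx)
  · intro x hx
    have h := hdisj x hx
    simp only [dirHull, mem_ofPred_eq, not_forall, not_le] at h
    obtain ⟨g, h1, h2, h3⟩ := h
    exact ⟨{y | 0 < g y},
      mem_nhdsWithin_of_mem_nhds ((h1.continuous hD hspan).continuousAt.eventually_const_lt h3),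
      g, h1, h2, fun _ h => h⟩

/-- A continuous function that fails to lie below a chord does so strictly at a leftmost
maximizer of the difference. -/
theorem exists_leftmost_max {ψ : ℝ → ℝ} (hψ : ContinuousOn ψ (Icc 0 1)) (h0 : ψ 0 ≤ 0)
    (h1 : ψ 1 ≤ 0) {z : ℝ} (hz : z ∈ Icc (0 : ℝ) 1) (hpos : 0 < ψ z) :
    ∃ s ∈ Ioo (0 : ℝ) 1, 0 < ψ s ∧ (∀ x ∈ Icc (0 : ℝ) 1, ψ x ≤ ψ s) ∧
      ∀ x ∈ Ico (0 : ℝ) s, ψ x < ψ s := by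
  obtain ⟨a, ha, hmax⟩ := isCompact_Icc.exists_isMaxOn ⟨z, hz⟩ hψ
  have hcl : IsCompact (Icc (0 : ℝ) 1 ∩ ψ ⁻¹' {ψ a}) :=
    isCompact_Icc.of_isClosed_subset (hψ.preimage_isClosed_of_isClosed isClosed_Icc
      isClosed_singleton) inter_subset_left
  obtain ⟨s, ⟨hs, hsa⟩, hleast⟩ := hcl.exists_isLeast ⟨a, ha, rfl⟩
  have hsa' : ψ s = ψ a := hsa
  have hmax' : ∀ x ∈ Icc (0 : ℝ) 1, ψ x ≤ ψ s := fun x hx => hsa' ▸ hmax hx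
  have hs0 : 0 < ψ s := hpos.trans_le (hmax' z hz)
  refine ⟨s, ⟨lt_of_le_of_ne hs.1 ?_, lt_of_le_of_ne hs.2 ?_⟩, hs0, hmax', ?_⟩
  · rintro rfl; linarith
  · rintro rfl; linarith
  · intro x hx
    have hx' : x ∈ Icc (0 : ℝ) 1 := ⟨hx.1, hx.2.le.trans hs.2⟩
    refine lt_of_le_of_ne (hmax' x hx') fun h => ?_
    exact absurd (hleast ⟨hx', h.trans hsa'⟩) (not_le.2 hx.2)

omit [FiniteDimensional ℝ V] in
/-- Gluing: the maximum of `g` with a function `F` that is only defined on an open set and is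
dominated by `g` at the frontier. -/
theorem DirConvexOn.glue (hD : ∀ η ∈ D, ∀ c : ℝ, c ≠ 0 → c • η ∈ D) {U : Set V} (hU : IsOpen U)
    {F g : V → ℝ} (hFc : Continuous F) (hgc : Continuous g) (hF : DirConvexOn D U F)
    (hg : DirConvexOn D univ g) (hfr : ∀ x ∈ frontier U, F x ≤ g x) [∀ x, Decidable (x ∈ U)] :
    DirConvexOn D univ fun x => if x ∈ U then max (F x) (g x) else g x := by
  set G : V → ℝ := fun x => if x ∈ U then max (F x) (g x) else g x with hG
  have hGc : Continuous G :=
    Continuous.if (fun a ha => max_eq_right (hfr a ha)) (hFc.max hgc) hgc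
  have hgG : ∀ x, g x ≤ G x := fun x => by
    simp only [hG]; split_ifs
    exacts [le_max_right _ _, le_rfl]
  have hFG : ∀ x ∈ U, F x ≤ G x := fun x hx => by
    simp only [hG, if_pos hx]
    exact le_max_left _ _
  have hcase : ∀ x, G x = g x ∨ x ∈ U ∧ G x = F x := fun x => by
    by_cases hx : x ∈ U
    · rcases max_choice (F x) (g x) with h | h
      · right; exact ⟨hx, by simp only [hG, if_pos hx, h]⟩
      · left; simp only [hG, if_pos hx, h]
    · left; simp only [hG, if_neg hx]
  intro x _ y _ _ hd r hr
  by_contra! hlt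
  set γ : ℝ → V := fun s => y + s • (x - y) with hγ
  have hγc : Continuous γ := by fun_prop
  have hr' : r • x + (1 - r) • y = γ r := by simp only [hγ]; module
  set A : ℝ → ℝ := fun s => s * G x + (1 - s) * G y with hA
  have hAc : Continuous A := by fun_prop
  have hγ0 : γ 0 = y := by simp [hγ]
  have hγ1 : γ 1 = x := by simp [hγ]
  obtain ⟨s, hs, hpos, hmax, hleft⟩ := exists_leftmost_max (ψ := fun s => G (γ s) - A s)
    (by fun_prop) (by simp [hA, hγ0]) (by simp [hA, hγ1]) hr (by
      rw [hr'] at hlt; simp only [hA]; linarith)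
  have hgconv : ConvexOn ℝ univ fun s => g (γ s) :=
    hg.convexOn_line hD hd convex_univ fun _ _ => mem_univ _
  -- If `G = g` at the maximizer, convexity of `g` along the whole line and `g ≤ G` at the ends
  -- exclude a value above the chord.
  rcases hcase (γ s) with h | ⟨hsU, h⟩
  · have h2 := hgconv.2 (mem_univ 1) (mem_univ 0) hs.1.le (by linarith [hs.2] : 0 ≤ 1 - s)
      (by ring)
    simp only [smul_eq_mul, mul_one, mul_zero, add_zero, hγ0, hγ1] at h2
    have h3 := mul_le_mul_of_nonneg_left (hgG x) hs.1.le
    have h4 := mul_le_mul_of_nonneg_left (hgG y) (by linarith [hs.2] : 0 ≤ 1 - s)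
    simp only [hA, h] at hpos
    linarith
  -- Otherwise `G = F` at the maximizer, and `F ≤ G` is convex nearby. The midpoint inequality on a
  -- small symmetric interval contradicts that the difference is strictly smaller on the left and
  -- not larger on the right.
  · have hn : γ ⁻¹' U ∩ Ioo 0 1 ∈ 𝓝 s :=
      inter_mem ((hU.preimage hγc).mem_nhds hsU) (Ioo_mem_nhds hs.1 hs.2)
    obtain ⟨ρ, hρ, hball⟩ := Metric.nhds_basis_closedBall.mem_iff.1 hn
    rw [Real.closedBall_eq_Icc] at hball
    have hFconv : ConvexOn ℝ (Icc (s - ρ) (s + ρ)) fun s => F (γ s) :=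
      hF.convexOn_line hD hd (convex_Icc _ _) fun s hs => (hball hs).1
    have hm1 : s - ρ ∈ Icc (s - ρ) (s + ρ) := ⟨le_rfl, by linarith⟩
    have hm2 : s + ρ ∈ Icc (s - ρ) (s + ρ) := ⟨by linarith, le_rfl⟩
    have h2 := hFconv.2 hm1 hm2 (show (0 : ℝ) ≤ 1 / 2 by norm_num)
      (show (0 : ℝ) ≤ 1 / 2 by norm_num) (by norm_num)
    have hmid : (1 / 2 : ℝ) • (s - ρ) + (1 / 2 : ℝ) • (s + ρ) = s := by
      simp only [smul_eq_mul]; ring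
    simp only [hmid] at h2
    simp only [smul_eq_mul] at h2
    have h3 := hFG _ (hball hm1).1
    have h4 := hFG _ (hball hm2).1
    have h5 := hleft (s - ρ) ⟨(hball hm1).2.1.le, by linarith⟩
    have h6 := hmax (s + ρ) ⟨(hball hm2).2.1.le, (hball hm2).2.2.le⟩
    simp only [hA, h] at h5 h6
    linarith

/-- A function that is convex in the directions `D` near the hull of `K` agrees on the hull with
one that is convex in the directions `D` everywhere. -/
theorem DirConvexOn.exists_eqOn_dirHull (hD : ∀ η ∈ D, ∀ c : ℝ, c ≠ 0 → c • η ∈ D)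
    (hspan : Submodule.span ℝ D = ⊤) (hK : IsCompact K) {U : Set V} (hU : IsOpen U)
    (hKU : dirHull D K ⊆ U) {F : V → ℝ} (hFc : Continuous F) (hF : DirConvexOn D U F) :
    ∃ G : V → ℝ, DirConvexOn D univ G ∧ ∀ x ∈ dirHull D K, G x = F x := by
  classical
  have := FiniteDimensional.proper ℝ V
  have hQ := isCompact_dirHull hD hspan hK
  obtain ⟨R, hR⟩ := hQ.isBounded.subset_ball (0 : V)
  -- Cutting with a ball makes the frontier compact, so a single `g` is positive on all of it.
  set U' := U ∩ Metric.ball 0 R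
  have hU' : IsOpen U' := hU.inter Metric.isOpen_ball
  have hfrc : IsCompact (frontier U') :=
    Metric.isCompact_of_isClosed_isBounded isClosed_frontier
      ((Metric.isBounded_ball.subset inter_subset_right).closure.subset frontier_subset_closure)
  obtain ⟨g, hg, hgK, hgpos⟩ := exists_pos_of_disjoint_dirHull (K := K) hD hspan hfrc (by
    intro x hx hxQ
    rw [hU'.frontier_eq] at hx
    exact hx.2 ⟨hKU hxQ, hR hxQ⟩)
  have hgc := hg.continuous hD hspan
  -- On the hull `F - c ≥ 0 ≥ A * g`, so there the maximum selects `F - c`; the constant is added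
  -- back at the end.
  obtain ⟨c, hc⟩ := (hQ.image hFc).bddBelow
  have hFpos : ∀ x ∈ dirHull D K, 0 ≤ F x + -c := fun x hx => by
    have := hc (mem_image_of_mem F hx)
    linarith
  obtain ⟨B, hB⟩ := (hfrc.image hFc).bddAbove
  obtain ⟨A, hA0, hA⟩ : ∃ A : ℝ, 0 ≤ A ∧ ∀ x ∈ frontier U', F x + -c ≤ A * g x := by
    rcases (frontier U').eq_empty_or_nonempty with h | h
    · exact ⟨0, le_rfl, by simp [h]⟩
    obtain ⟨x₀, hx₀, hmin⟩ := hfrc.exists_isMinOn h hgc.continuousOn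
    have h0 := hgpos x₀ hx₀
    refine ⟨|B - c| / g x₀, by positivity, fun x hx => ?_⟩
    have h1 : g x₀ ≤ g x := hmin hx
    have h2 : F x ≤ B := hB (mem_image_of_mem F hx)
    calc F x + -c ≤ |B - c| := by linarith [le_abs_self (B - c)]
      _ = |B - c| / g x₀ * g x₀ := by field_simp
      _ ≤ _ := by gcongr
  refine ⟨_, ((DirConvexOn.glue hD hU' (F := fun x => F x + -c) (by fun_prop) (hgc.const_mul A)
    ((hF.mono inter_subset_left).add_const (-c)) (hg.const_mul hA0) hA)).add_const c, ?_⟩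
  intro x hx
  have h1 : A * g x ≤ 0 := mul_nonpos_of_nonneg_of_nonpos hA0 (hx g hg hgK)
  have h2 : max (F x + -c) (A * g x) = F x + -c := max_eq_left (h1.trans (hFpos x hx))
  simp only [if_pos (show x ∈ U' from ⟨hKU hx, hR hx⟩), h2]
  ring

end Hull

/-! ### Second-order criterion and the penalty for leaving the hyperplane -/

section Hessian

variable {V : Type*} [NormedAddCommGroup V] [NormedSpace ℝ V] {D : Set V}

theorem hasDerivAt_comp_line {E : Type*} [NormedAddCommGroup E] [NormedSpace ℝ E] {G : V → E}
    (hG : Differentiable ℝ G) (x η : V) (s : ℝ) :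
    HasDerivAt (fun s : ℝ => G (x + s • η)) (fderiv ℝ G (x + s • η) η) s := by
  have h1 : HasDerivAt (fun s : ℝ => x + s • η) η s := by
    simpa using ((hasDerivAt_id s).smul_const η).const_add x
  exact (hG (x + s • η)).hasFDerivAt.comp_hasDerivAt s h1

theorem hasDerivAt_fderiv_comp_line {G : V → ℝ} (hG : ContDiff ℝ 2 G) (x η : V) (s : ℝ) :
    HasDerivAt (fun s : ℝ => fderiv ℝ G (x + s • η) η)
      (fderiv ℝ (fderiv ℝ G) (x + s • η) η η) s := by
  have hd : Differentiable ℝ (fderiv ℝ G) :=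
    (hG.fderiv_right (m := 1) (by norm_num)).differentiable (by norm_num)
  exact ((hasDerivAt_comp_line hd x η s).clm_apply (hasDerivAt_const s η)).congr_deriv (by simp)

theorem hessian_nonneg_of_convexOn_line {G : V → ℝ} (hG : ContDiff ℝ 2 G) {x η : V} {a : ℝ}
    (ha : 0 < a) (hconv : ConvexOn ℝ (Ioo (-a) a) fun s : ℝ => G (x + s • η)) :
    0 ≤ fderiv ℝ (fderiv ℝ G) x η η := by
  have hd := hasDerivAt_comp_line (hG.differentiable (by norm_num)) x η
  have hmono := hconv.monotoneOn_deriv fun s _ => (hd s).differentiableAt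
  have hderiv : deriv (fun s : ℝ => G (x + s • η)) = fun s => fderiv ℝ G (x + s • η) η :=
    funext fun s => (hd s).deriv
  rw [hderiv] at hmono
  have h0 : (0 : ℝ) ∈ Ioo (-a) a := ⟨by linarith, ha⟩
  have h1 := hmono.derivWithin_nonneg (x := 0)
  rw [derivWithin_of_isOpen isOpen_Ioo h0, (hasDerivAt_fderiv_comp_line hG x η 0).deriv] at h1
  simpa using h1

/-- Only the expansion of `q` along lines is used: it contributes `2 * β η` to the second derivative
of the sum in direction `η`. -/
theorem dirConvexOn_of_hessian {G : V → ℝ} (hG : ContDiff ℝ 2 G) {q : V → ℝ} {β : V → ℝ}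
    {γ : V → V → ℝ} (hq : ∀ x η, ∀ s : ℝ, q (x + s • η) = q x + s * γ x η + s ^ 2 * β η)
    {U : Set V}
    (hpos : ∀ x ∈ U, ∀ η ∈ D, 0 ≤ fderiv ℝ (fderiv ℝ G) x η η + 2 * β η) :
    DirConvexOn D U fun x => G x + q x := by
  intro x hx y hy hs hd r hr
  have h1 := hasDerivAt_comp_line (hG.differentiable (by norm_num)) y (x - y)
  have h2 := hasDerivAt_fderiv_comp_line hG y (x - y)
  have hq1 : ∀ s : ℝ, HasDerivAt (fun s : ℝ => q (y + s • (x - y)))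
      (γ y (x - y) + 2 * s * β (x - y)) s := by
    intro s
    simp only [hq]
    have := (((hasDerivAt_id s).mul_const (γ y (x - y))).const_add (q y)).add
      (((hasDerivAt_id s).pow 2).mul_const (β (x - y)))
    refine this.congr_deriv ?_
    simp
  have hq2 : ∀ s : ℝ, HasDerivAt (fun s : ℝ => γ y (x - y) + 2 * s * β (x - y))
      (2 * β (x - y)) s := by
    intro s
    have := (((hasDerivAt_id s).const_mul 2).mul_const (β (x - y))).const_add (γ y (x - y))
    exact this.congr_deriv (by simp)
  have hconv : ConvexOn ℝ (Icc 0 1) fun s : ℝ => G (y + s • (x - y)) + q (y + s • (x - y)) := by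
    refine convexOn_of_hasDerivWithinAt2_nonneg (convex_Icc 0 1)
      (f' := fun s => fderiv ℝ G (y + s • (x - y)) (x - y) + (γ y (x - y) + 2 * s * β (x - y)))
      (f'' := fun s => fderiv ℝ (fderiv ℝ G) (y + s • (x - y)) (x - y) (x - y) + 2 * β (x - y))
      (fun s _ => ((h1 s).add (hq1 s)).continuousAt.continuousWithinAt)
      (fun s _ => ((h1 s).add (hq1 s)).hasDerivWithinAt)
      (fun s _ => ((h2 s).add (hq2 s)).hasDerivWithinAt) ?_
    intro s hs'
    rw [interior_Icc] at hs'
    refine hpos _ (hs ?_) _ hd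
    exact ⟨s, 1 - s, hs'.1.le, by linarith [hs'.2], by ring, by module⟩
  have h3 := hconv.2 (show (1 : ℝ) ∈ Icc (0 : ℝ) 1 by simp) (show (0 : ℝ) ∈ Icc (0 : ℝ) 1 by simp)
    hr.1 (by linarith [hr.2] : 0 ≤ 1 - r) (by ring)
  have h4 : y + r • (x - y) = r • x + (1 - r) • y := by module
  simp only [smul_eq_mul, mul_one, mul_zero, add_zero, h4, one_smul, zero_smul,
    add_sub_cancel] at h3
  exact h3

/-- On the compact set where `u ≤ 0`, `v` is positive and hence bounded away from zero, so a large
`k` compensates the lower bound of `u`. -/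
theorem exists_add_mul_pos {X : Type*} [TopologicalSpace X] {C : Set X} (hC : IsCompact C)
    {u v : X → ℝ} (hu : ContinuousOn u C) (hv : ContinuousOn v C) (hv0 : ∀ x ∈ C, 0 ≤ v x)
    (huv : ∀ x ∈ C, v x = 0 → 0 < u x) : ∃ k : ℝ, ∀ x ∈ C, 0 < u x + k * v x := by
  have hcl : IsCompact (C ∩ u ⁻¹' Iic 0) := by
    obtain ⟨s, hs, hs'⟩ := (continuousOn_iff_isClosed.1 hu) (Iic 0) isClosed_Iic
    rw [inter_comm, hs']
    exact hC.inter_left hs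
  obtain ⟨B, hB⟩ := (hC.image_of_continuousOn hu).bddBelow
  rcases (C ∩ u ⁻¹' Iic 0).eq_empty_or_nonempty with h | h
  · refine ⟨0, fun x hx => ?_⟩
    have : x ∉ C ∩ u ⁻¹' Iic 0 := by simp [h]
    simpa [hx] using this
  obtain ⟨x₀, hx₀, hmin⟩ := hcl.exists_isMinOn h (hv.mono inter_subset_left)
  have h0 : 0 < v x₀ := by
    refine lt_of_le_of_ne (hv0 _ hx₀.1) fun h => ?_
    exact absurd (huv _ hx₀.1 h.symm) (not_lt.2 hx₀.2)
  refine ⟨(|B| + 1) / v x₀, fun x hx => ?_⟩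
  by_cases hux : u x ≤ 0
  · have h1 : v x₀ ≤ v x := hmin ⟨hx, hux⟩
    have h2 : B ≤ u x := hB (mem_image_of_mem u hx)
    have h3 : |B| + 1 ≤ (|B| + 1) / v x₀ * v x := by
      calc |B| + 1 = (|B| + 1) / v x₀ * v x₀ := by field_simp
        _ ≤ _ := by gcongr
    linarith [neg_abs_le B]
  · have h1 := hv0 x hx
    have h2 : 0 ≤ (|B| + 1) / v x₀ * v x := by positivity
    linarith [not_le.1 hux]

variable [FiniteDimensional ℝ V]

/-- A smooth function that is infinitesimally convex in the directions of `D` tangent to a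
hyperplane becomes convex in all directions of `D` after adding a small multiple of a strictly
convex function and a large multiple of the squared distance to the hyperplane. -/
theorem exists_dirConvexOn_add_sq (hD : ∀ η ∈ D, ∀ c : ℝ, c ≠ 0 → c • η ∈ D)
    (hcl : IsClosed (insert 0 D)) (ℓ : V →L[ℝ] ℝ) (t : ℝ) {G : V → ℝ} (hG : ContDiff ℝ 2 G)
    {C : Set V} (hC : IsCompact C)
    (hpos : ∀ x ∈ C, ∀ η ∈ D, ℓ η = 0 → 0 ≤ fderiv ℝ (fderiv ℝ G) x η η) {ε : ℝ} (hε : 0 < ε) :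
    ∃ k : ℝ, DirConvexOn D C fun x => G x + (ε * ‖toEuclidean x‖ ^ 2 + k * (ℓ x - t) ^ 2) := by
  have := FiniteDimensional.proper ℝ V
  have hc2 : Continuous (fderiv ℝ (fderiv ℝ G)) :=
    (hG.fderiv_right (m := 1) (by norm_num)).continuous_fderiv (by norm_num)
  -- By homogeneity unit directions suffice, and those in `D` form a compact set. The penalty
  -- vanishes only on tangent directions, where the `ε` term gives strict positivity.
  obtain ⟨k, hk⟩ := exists_add_mul_pos (hC.prod ((isCompact_sphere (0 : V) 1).inter_right hcl))
    (u := fun p => fderiv ℝ (fderiv ℝ G) p.1 p.2 p.2 + 2 * (ε * ‖toEuclidean p.2‖ ^ 2))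
    (v := fun p => 2 * ℓ p.2 ^ 2) (by fun_prop) (by fun_prop) (fun p _ => by positivity) (by
      rintro ⟨x, η⟩ ⟨hx, hη1, hη2⟩ h
      have hη0 : η ≠ 0 := by
        rintro rfl; simp at hη1
      have hηD : η ∈ D := hη2.resolve_left hη0
      have hℓ : ℓ η = 0 := by simpa using h
      have h1 := hpos x hx η hηD hℓ
      have h2 : 0 < ‖toEuclidean η‖ := by simpa using hη0
      have h3 : 0 < 2 * (ε * ‖toEuclidean η‖ ^ 2) := by positivity
      dsimp only
      linarith)
  -- The norm of `toEuclidean` is used because its square is quadratic along lines; the given norm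
  -- need not come from an inner product.
  refine ⟨k, dirConvexOn_of_hessian hG (β := fun η => ε * ‖toEuclidean η‖ ^ 2 + k * ℓ η ^ 2)
    (γ := fun x η => ε * (2 * inner ℝ (toEuclidean x) (toEuclidean η)) +
      k * (2 * (ℓ x - t) * ℓ η)) ?_ ?_⟩
  · intro x η s
    rw [map_add, map_smul, norm_add_sq_real, inner_smul_right, norm_smul, map_add, map_smul,
      mul_pow, Real.norm_eq_abs, sq_abs, smul_eq_mul]
    ring
  · intro x hx η hη
    rcases eq_or_ne η 0 with rfl | hη0
    · simp
    have hn : 0 < ‖η‖ := norm_pos_iff.2 hη0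
    set ζ := ‖η‖⁻¹ • η with hζ
    have hηζ : η = ‖η‖ • ζ := by rw [hζ, smul_smul, mul_inv_cancel₀ hn.ne', one_smul]
    have h := hk (x, ζ) ⟨hx, by simp [hζ, norm_smul, hn.ne'],
      mem_insert_of_mem _ (hD η hη _ (inv_ne_zero hn.ne'))⟩
    dsimp only at h
    have h2 : fderiv ℝ (fderiv ℝ G) x η η + 2 * (ε * ‖toEuclidean η‖ ^ 2 + k * ℓ η ^ 2)
        = ‖η‖ ^ 2 * (fderiv ℝ (fderiv ℝ G) x ζ ζ + 2 * (ε * ‖toEuclidean ζ‖ ^ 2)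
          + k * (2 * ℓ ζ ^ 2)) := by
      conv_lhs => rw [hηζ]
      simp only [map_smul, _root_.smul_apply, smul_eq_mul, norm_smul, norm_norm]
      ring
    rw [h2]
    positivity

end Hessian

/-! ### Smoothing and extension from the hyperplane -/

section Mollify

open scoped Convolution

variable {V : Type*} [NormedAddCommGroup V] [NormedSpace ℝ V] [FiniteDimensional ℝ V]
  [MeasurableSpace V] [BorelSpace V] {D : Set V}

omit [NormedSpace ℝ V] [FiniteDimensional ℝ V] [MeasurableSpace V] [BorelSpace V] in
theorem mem_cthickening_of_dist_le_add {Q : Set V} {a b c : ℝ} (ha : 0 ≤ a) (hb : 0 ≤ b)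
    (habc : a + b ≤ c) {x y : V} (hx : x ∈ Metric.cthickening a Q) (hxy : dist y x ≤ b) :
    y ∈ Metric.cthickening c Q := by
  refine Metric.cthickening_mono (by linarith : b + a ≤ c) Q
    (Metric.cthickening_cthickening_subset hb ha Q ?_)
  exact Metric.mem_cthickening_of_dist_le y x b _ hx hxy

/-- A function on a relatively open subset of a hyperplane that is convex in the directions of `D`
can be approximated near a compact set by smooth functions on the whole space that are
infinitesimally convex in the directions of `D` tangent to the hyperplane. -/
theorem DirConvexOn.exists_smooth_approx (hD : ∀ η ∈ D, ∀ c : ℝ, c ≠ 0 → c • η ∈ D)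
    {ℓ : V →L[ℝ] ℝ} (hℓ : ℓ ≠ 0) {t : ℝ} {U Q : Set V} (hU : IsOpen U) (hQ : IsCompact Q)
    (hQU : Q ⊆ U ∩ {x | ℓ x = t}) {f : V → ℝ} (hf : DirConvexOn D (U ∩ {x | ℓ x = t}) f)
    (hfc : ContinuousOn f (U ∩ {x | ℓ x = t})) {ε : ℝ} (hε : 0 < ε) :
    ∃ G : V → ℝ, ContDiff ℝ 2 G ∧ (∀ x ∈ Q, |G x - f x| ≤ ε) ∧ ∃ δ > 0,
      ∀ x ∈ Metric.cthickening δ Q, ∀ η ∈ D, ℓ η = 0 → 0 ≤ fderiv ℝ (fderiv ℝ G) x η η := by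
  have := FiniteDimensional.proper ℝ V
  obtain ⟨u, hu⟩ : ∃ u, ℓ u = 1 := by
    obtain ⟨v, hv⟩ : ∃ v, ℓ v ≠ 0 := by
      by_contra! h; exact hℓ (ContinuousLinearMap.ext h)
    exact ⟨(ℓ v)⁻¹ • v, by simp [hv]⟩
  -- Projection onto the hyperplane along the transversal vector `u`; it commutes with tangent
  -- translations, so `f ∘ P` inherits convexity in tangent directions.
  set P : V → V := fun x => x - (ℓ x - t) • u with hP
  have hPc : Continuous P := by fun_prop
  have hPS : ∀ x, ℓ (P x) = t := fun x => by simp [hP, hu]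
  have hPQ : ∀ x ∈ Q, P x = x := fun x hx => by
    have : ℓ x = t := (hQU hx).2
    simp [hP, this]
  have hPadd : ∀ x η, ℓ η = 0 → ∀ s : ℝ, P (x + s • η) = P x + s • η := fun x η hη s => by
    simp only [hP, map_add, map_smul, hη, smul_zero, add_zero]; abel
  obtain ⟨δ, hδ, hδW⟩ := hQ.exists_cthickening_subset_open (hU.preimage hPc) (fun x hx => by
    rw [mem_preimage, hPQ x hx]; exact (hQU hx).1)
  set C := Metric.cthickening δ Q with hC
  have hCc : IsCompact C := hQ.cthickening
  have hCP : ∀ x ∈ C, P x ∈ U ∩ {x | ℓ x = t} := fun x hx => ⟨hδW hx, hPS x⟩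
  have hfPc : ContinuousOn (fun x => f (P x)) C := hfc.comp hPc.continuousOn hCP
  -- Cutting off to `C` gives integrability; all points relevant below remain in `C`.
  set h₀ : V → ℝ := C.indicator fun x => f (P x) with hh₀
  set μ : Measure V := Measure.addHaar
  have hint : Integrable h₀ μ :=
    (hfPc.integrableOn_compact hCc).integrable_indicator hCc.measurableSet
  have huc := hCc.uniformContinuousOn_of_continuous hfPc
  obtain ⟨ρ', hρ', hρε⟩ := Metric.uniformContinuousOn_iff.1 huc ε hε
  set ρ := min ρ' (δ / 4) with hρ
  have hρ0 : 0 < ρ := by positivity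
  let φ : ContDiffBump (0 : V) := ⟨ρ / 2, ρ, by positivity, by linarith⟩
  set G : V → ℝ := (φ.normed μ ⋆[ContinuousLinearMap.lsmul ℝ ℝ, μ] h₀) with hG
  have hGx : ∀ x, G x = ∫ y, φ.normed μ y * h₀ (x - y) ∂μ := fun x => rfl
  have hGi : ∀ x, Integrable (fun y => φ.normed μ y * h₀ (x - y)) μ := fun x =>
    (φ.hasCompactSupport_normed.convolutionExists_left (ContinuousLinearMap.lsmul ℝ ℝ)
      φ.continuous_normed hint.locallyIntegrable) x
  have hGs : ContDiff ℝ 2 G := φ.hasCompactSupport_normed.contDiff_convolution_left _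
    φ.contDiff_normed hint.locallyIntegrable
  refine ⟨G, hGs, fun x hx => ?_, δ / 4, by positivity, fun x hx η hη hη0 => ?_⟩
  · have hxC : x ∈ C := Metric.self_subset_cthickening Q hx
    have hfx : h₀ x = f x := by rw [hh₀, indicator_of_mem hxC, hPQ x hx]
    have := φ.dist_normed_convolution_le (μ := μ) (g := h₀) (x₀ := x) (ε := ε)
      hint.aestronglyMeasurable (by
        intro y hy
        rw [Metric.mem_ball] at hy
        have hy1 : dist y x < ρ' := hy.trans_le (min_le_left _ _)
        have hy2 : dist y x ≤ δ := hy.le.trans ((min_le_right _ _).trans (by linarith))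
        have hyC : y ∈ C := Metric.mem_cthickening_of_dist_le y x δ Q hx hy2
        rw [hh₀, indicator_of_mem hxC, indicator_of_mem hyC]
        exact (hρε y hyC x hxC hy1).le)
    rw [hfx, Real.dist_eq] at this
    exact this
  -- The distance of `x` to `Q`, the shift by `s • η` and the mollification radius each cost at most
  -- `δ / 4`. The `+ 1` avoids division by zero.
  · set a := δ / 4 / (‖η‖ + 1) with ha
    have ha0 : 0 < a := by positivity
    have haη : a * ‖η‖ ≤ δ / 4 := by
      calc a * ‖η‖ ≤ a * (‖η‖ + 1) := by gcongr; linarith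
        _ = δ / 4 := by rw [ha]; field_simp
    have hmem : ∀ y, ‖y‖ ≤ ρ → ∀ s ∈ Ioo (-a) a, x + s • η - y ∈ C := by
      intro y hy s hs
      refine mem_cthickening_of_dist_le_add (a := δ / 4) (b := δ / 2) (by positivity)
        (by positivity) (by linarith) hx ?_
      have h1 : |s| * ‖η‖ ≤ δ / 4 := le_trans (by gcongr; exact (abs_lt.2 hs).le) haη
      calc dist (x + s • η - y) x = ‖s • η - y‖ := by rw [dist_eq_norm]; congr 1; abel
        _ ≤ ‖s • η‖ + ‖y‖ := norm_sub_le _ _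
        _ ≤ δ / 4 + δ / 4 := by
          rw [norm_smul, Real.norm_eq_abs]
          exact add_le_add h1 (hy.trans (min_le_right _ _))
        _ = δ / 2 := by ring
    refine hessian_nonneg_of_convexOn_line hGs ha0 ⟨convex_Ioo _ _, fun b hb c hc p q hp hq hpq => ?_⟩
    simp only [hGx, smul_eq_mul]
    rw [← integral_const_mul, ← integral_const_mul,
      ← integral_add ((hGi _).const_mul _) ((hGi _).const_mul _)]
    refine integral_mono (hGi _) (((hGi _).const_mul _).add ((hGi _).const_mul _)) fun y => ?_
    dsimp only
    by_cases hy : ‖y‖ ≤ ρ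
    · have hval : ∀ s ∈ Ioo (-a) a, h₀ (x + s • η - y) = f (P (x - y) + s • η) := by
        intro s hs
        rw [hh₀, indicator_of_mem (hmem y hy s hs), ← hPadd _ _ hη0]
        congr 2; abel
      have hline := hf.convexOn_line hD hη (convex_Ioo (-a) a) (x := P (x - y)) (fun s hs => by
        rw [← hPadd _ _ hη0, show x - y + s • η = x + s • η - y by abel]
        exact hCP _ (hmem y hy s hs))
      have h1 := hline.2 hb hc hp hq hpq
      simp only [smul_eq_mul] at h1
      rw [hval b hb, hval c hc, hval _ (by simpa using convex_Ioo (-a) a hb hc hp hq hpq)]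
      have h2 := mul_le_mul_of_nonneg_left h1 (φ.nonneg_normed (μ := μ) y)
      linarith
    · have : φ.normed μ y = 0 := by
        have : y ∉ Function.support (φ.normed μ) := by
          rw [φ.support_normed_eq, mem_ball_zero_iff]
          exact fun h => hy h.le
        simpa using this
      simp [this]

/-- A function on a relatively open subset of a hyperplane containing the hull of `K` that is convex
in the directions of `D` can be approximated uniformly on the hull by functions on the whole space
that are convex in the directions of `D`. -/
theorem DirConvexOn.exists_extension (hD : ∀ η ∈ D, ∀ c : ℝ, c ≠ 0 → c • η ∈ D)
    (hcl : IsClosed (insert 0 D)) (hspan : Submodule.span ℝ D = ⊤)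
    {ℓ : V →L[ℝ] ℝ} (hℓ : ℓ ≠ 0)
    (hspanℓ : LinearMap.ker (ℓ : V →ₗ[ℝ] ℝ) ≤
      Submodule.span ℝ (D ∩ (LinearMap.ker (ℓ : V →ₗ[ℝ] ℝ) : Set V))) {t : ℝ}
    {K U : Set V} (hK : IsCompact K) (hU : IsOpen U) (hKU : dirHull D K ⊆ U ∩ {x | ℓ x = t})
    {f : V → ℝ} (hf : DirConvexOn D (U ∩ {x | ℓ x = t}) f) {ε : ℝ} (hε : 0 < ε) :
    ∃ G : V → ℝ, DirConvexOn D univ G ∧ ∀ x ∈ dirHull D K, |G x - f x| ≤ ε := by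
  have hQ := isCompact_dirHull hD hspan hK
  have hfc : ContinuousOn f (U ∩ {x | ℓ x = t}) :=
    hf.continuousOn hD hspanℓ (S := {x | ℓ x = t})
      (fun x (hx : ℓ x = t) y => by
        change ℓ y = t ↔ ℓ (y - x) = 0
        rw [map_sub, hx, sub_eq_zero]) hU rfl
  obtain ⟨G, hGs, hGf, δ, hδ, hG⟩ := hf.exists_smooth_approx hD hℓ hU hQ hKU hfc (half_pos hε)
  have hqc : Continuous fun x : V => ‖toEuclidean x‖ ^ 2 := by fun_prop
  obtain ⟨B, hB⟩ := (hQ.image hqc).bddAbove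
  -- Half of the error is spent on mollification, half on the strictly convex term; the penalty is
  -- zero on the hull.
  set ε' := ε / 2 / (|B| + 1) with hε'
  have hε'0 : 0 < ε' := by positivity
  obtain ⟨k, hk⟩ := exists_dirConvexOn_add_sq hD hcl ℓ t hGs hQ.cthickening hG hε'0
  obtain ⟨H, hH, hHG⟩ := (hk.mono (Metric.thickening_subset_cthickening δ _)).exists_eqOn_dirHull
    hD hspan hK Metric.isOpen_thickening (Metric.self_subset_thickening hδ _)
    (by have := hGs.continuous; fun_prop)
  refine ⟨H, hH, fun x hx => ?_⟩
  have hxt : ℓ x = t := (hKU hx).2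
  have h1 : ε' * ‖toEuclidean x‖ ^ 2 ≤ ε / 2 := by
    have : ‖toEuclidean x‖ ^ 2 ≤ |B| + 1 :=
      (hB (mem_image_of_mem _ hx)).trans (by linarith [le_abs_self B])
    calc ε' * ‖toEuclidean x‖ ^ 2 ≤ ε' * (|B| + 1) := by gcongr
      _ = ε / 2 := by rw [hε']; field_simp
  have h2 : 0 ≤ ε' * ‖toEuclidean x‖ ^ 2 := by positivity
  have h3 := abs_le.1 (hGf x hx)
  rw [hHG x hx, hxt, abs_le]
  constructor <;> ring_nf at h1 h2 h3 ⊢ <;> linarith [h3.1, h3.2]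

end Mollify

open Finsupp

/-! ### Finite splittings and the convex envelope they define -/

section Prelaminate

variable {V : Type*} [AddCommGroup V] [Module ℝ V]

/-- Finitely supported weights obtained from the unit mass at a point of `O` by splitting points of
`O` in the directions of `D` along segments in `O`. Trivial splittings are allowed, and so are
coincidences between the points; the first argument is the starting point. -/
inductive IsPrelaminate (D O : Set V) : V → (V →₀ ℝ) → Prop
  | single (x : V) (hx : x ∈ O) : IsPrelaminate D O x (Finsupp.single x 1)
  | split (x y : V) (p q : V →₀ ℝ) (s : ℝ) (hs₀ : 0 < s) (hs₁ : s < 1)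
      (hseg : segment ℝ x y ⊆ O) (hd : x - y ∈ insert 0 D)
      (hp : IsPrelaminate D O x p) (hq : IsPrelaminate D O y q) :
      IsPrelaminate D O (s • x + (1 - s) • y) (s • p + (1 - s) • q)

/-- Finitely supported weights obtained from the unit mass at a point of `O` by splitting points of
`O` in the directions of `D` along segments in `O`, such that new points never coincide with old
ones. -/
inductive IsAtomicLaminate (D O : Set V) : (V →₀ ℝ) → Prop
  | single (x : V) (hx : x ∈ O) : IsAtomicLaminate D O (Finsupp.single x 1)
  | split (q : V →₀ ℝ) (x y z : V) (w : ℝ) (hw : 0 < w) (s : ℝ) (hs₀ : 0 < s) (hs₁ : s < 1)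
      (hx : s • y + (1 - s) • z = x) (hxq : x ∉ q.support)
      (hq : IsAtomicLaminate D O (q + Finsupp.single x w))
      (hseg : segment ℝ y z ⊆ O) (hd : y - z ∈ D) (hyq : y ∉ q.support) (hzq : z ∉ q.support) :
      IsAtomicLaminate D O (q + Finsupp.single y (w * s) + Finsupp.single z (w * (1 - s)))

variable {D O : Set V} {g : V → ℝ}

/-- Keeps the set in `dirEnvelope` bounded below, so that `sInf` is a true infimum there. -/
theorem IsPrelaminate.le_linearCombination {x : V} {p : V →₀ ℝ} (h : IsPrelaminate D O x p) {c : ℝ}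
    (hg : ∀ y ∈ O, c ≤ g y) : c ≤ linearCombination ℝ g p := by
  induction h with
  | single x hx => simpa using hg x hx
  | split x y p q s hs₀ hs₁ hseg hd hp hq ihp ihq =>
    simp only [map_add, map_smul, smul_eq_mul]
    have h1 := mul_le_mul_of_nonneg_left ihp hs₀.le
    have h2 := mul_le_mul_of_nonneg_left ihq (by linarith : 0 ≤ 1 - s)
    linarith

/-- The largest function below `g` on `O` that is convex in the directions of `D`. -/
noncomputable def dirEnvelope (D O : Set V) (g : V → ℝ) (x : V) : ℝ :=
  sInf {y | ∃ p, IsPrelaminate D O x p ∧ linearCombination ℝ g p = y}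

theorem dirEnvelope_le {c : ℝ} (hg : ∀ y ∈ O, c ≤ g y) {x : V} {p : V →₀ ℝ}
    (h : IsPrelaminate D O x p) : dirEnvelope D O g x ≤ linearCombination ℝ g p :=
  csInf_le ⟨c, by rintro _ ⟨p, hp, rfl⟩; exact hp.le_linearCombination hg⟩ ⟨p, h, rfl⟩

theorem dirEnvelope_le_self {c : ℝ} (hg : ∀ y ∈ O, c ≤ g y) {x : V} (hx : x ∈ O) :
    dirEnvelope D O g x ≤ g x := by
  simpa using dirEnvelope_le hg (IsPrelaminate.single (D := D) x hx)

theorem le_dirEnvelope {x : V} (hx : x ∈ O) {c : ℝ}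
    (h : ∀ p, IsPrelaminate D O x p → c ≤ linearCombination ℝ g p) : c ≤ dirEnvelope D O g x :=
  le_csInf ⟨_, _, IsPrelaminate.single x hx, rfl⟩ (by rintro _ ⟨p, hp, rfl⟩; exact h p hp)

theorem exists_lt_of_dirEnvelope_lt {x : V} (hx : x ∈ O) {c : ℝ} (h : dirEnvelope D O g x < c) :
    ∃ p, IsPrelaminate D O x p ∧ linearCombination ℝ g p < c := by
  by_contra! H
  exact absurd (le_dirEnvelope hx H) (not_le.2 h)

/-- Nearly optimal prelaminates at the ends of a segment combine, by one more splitting, into a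
competitor at the intermediate point. -/
theorem dirConvexOn_dirEnvelope {c : ℝ} (hg : ∀ y ∈ O, c ≤ g y) :
    DirConvexOn D O (dirEnvelope D O g) := by
  intro x hx y hy hseg hd r hr
  rcases hr.1.eq_or_lt with rfl | hr0
  · simp
  rcases hr.2.eq_or_lt with rfl | hr1
  · simp
  refine le_of_forall_pos_le_add fun ε hε => ?_
  obtain ⟨p, hp, hpε⟩ := exists_lt_of_dirEnvelope_lt hx
    (show dirEnvelope D O g x < dirEnvelope D O g x + ε by linarith)
  obtain ⟨q, hq, hqε⟩ := exists_lt_of_dirEnvelope_lt hy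
    (show dirEnvelope D O g y < dirEnvelope D O g y + ε by linarith)
  have h := dirEnvelope_le hg
    (IsPrelaminate.split x y p q r hr0 hr1 hseg (mem_insert_of_mem _ hd) hp hq)
  simp only [map_add, map_smul, smul_eq_mul] at h
  have h1 := mul_le_mul_of_nonneg_left hpε.le hr0.le
  have h2 := mul_le_mul_of_nonneg_left hqε.le (by linarith : 0 ≤ 1 - r)
  linarith

/-- The prelaminates with a given starting point form a convex set. -/
theorem convex_setOf_isPrelaminate {x : V} (hx : x ∈ O) :
    Convex ℝ {p : V →₀ ℝ | IsPrelaminate D O x p} := by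
  rw [convex_iff_forall_pos]
  intro p hp q hq a b ha hb hab
  obtain rfl : b = 1 - a := by linarith
  -- The trivial splitting of `x` into `x` and `x`; this is why the direction `0` is admitted.
  have h := IsPrelaminate.split x x p q a ha (by linarith) (by simpa using hx) (by simp) hp hq
  rwa [← add_smul, add_sub_cancel, one_smul] at h

theorem IsAtomicLaminate.mono {O' : Set V} (hO : O ⊆ O') {p : V →₀ ℝ}
    (h : IsAtomicLaminate D O p) : IsAtomicLaminate D O' p := by
  induction h with
  | single x hx => exact .single x (hO hx)
  | split q x y z w hw s hs₀ hs₁ hx hxq hq hseg hd hyq hzq ih =>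
    exact .split q x y z w hw s hs₀ hs₁ hx hxq ih (hseg.trans hO) hd hyq hzq

end Prelaminate

/-! ### Perturbing splittings to make the atoms distinct -/

section Approximation

variable {V : Type*} [NormedAddCommGroup V] [NormedSpace ℝ V] {D : Set V}

/-- A nonzero `d` is shortened slightly, and `d = 0` is replaced by a small multiple of `d₀`; both
stay in the cone. Only finitely many parameters place a new point in `F`. -/
theorem exists_direction_avoiding (hD : ∀ η ∈ D, ∀ c : ℝ, c ≠ 0 → c • η ∈ D) (h0 : 0 ∉ D)
    {ℓ : V →L[ℝ] ℝ} {d₀ : V} (hd₀ : d₀ ∈ D) (hℓd₀ : ℓ d₀ = 0) {d : V} (hd : d ∈ insert 0 D)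
    (hℓd : ℓ d = 0) {δ : ℝ} (hδ : 0 < δ) {s : ℝ} (hs₀ : 0 < s) (hs₁ : s < 1) (x : V)
    (F : Finset V) :
    ∃ e ∈ D, ℓ e = 0 ∧ ‖e - d‖ < δ ∧ x + (1 - s) • e ∉ F ∧ x - s • e ∉ F := by
  obtain ⟨c, hc0, hℓc, hc⟩ : ∃ c : V, c ≠ 0 ∧ ℓ c = 0 ∧ ∀ τ ∈ Ioo (0 : ℝ) 1, d + τ • c ∈ D := by
    by_cases h : d = 0
    · subst h
      refine ⟨d₀, fun h => h0 (h ▸ hd₀), hℓd₀, fun τ hτ => ?_⟩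
      rw [zero_add]
      exact hD _ hd₀ _ hτ.1.ne'
    · refine ⟨-d, neg_ne_zero.2 h, by simp [hℓd], fun τ hτ => ?_⟩
      rw [show d + τ • -d = (1 - τ) • d by module]
      exact hD _ (hd.resolve_left h) _ (by linarith [hτ.2])
  have hinj : ∀ a : ℝ, a ≠ 0 → Function.Injective fun τ : ℝ => x + a • (d + τ • c) := by
    intro a ha τ τ' h
    have h1 := smul_right_injective V ha (add_left_cancel h)
    exact smul_left_injective ℝ hc0 (add_left_cancel h1)
  have hfin : ∀ a : ℝ, a ≠ 0 → {τ : ℝ | x + a • (d + τ • c) ∈ F}.Finite := fun a ha =>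
    F.finite_toSet.preimage (hinj a ha).injOn
  have hb : 0 < min 1 (δ / ‖c‖) := lt_min one_pos (div_pos hδ (norm_pos_iff.2 hc0))
  obtain ⟨τ, hτ, hτ'⟩ := (Ioo_infinite hb).exists_notMem_finite
    ((hfin (1 - s) (by linarith)).union (hfin (-s) (by linarith)))
  simp only [mem_union, mem_ofPred_eq, not_or, neg_smul, ← sub_eq_add_neg] at hτ'
  refine ⟨d + τ • c, hc τ ⟨hτ.1, hτ.2.trans_le (min_le_left _ _)⟩, by simp [hℓd, hℓc], ?_, hτ'⟩
  rw [add_sub_cancel_left, norm_smul, Real.norm_eq_abs, abs_of_pos hτ.1]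
  exact (lt_div_iff₀ (norm_pos_iff.2 hc0)).1 (hτ.2.trans_le (min_le_right _ _))

/-- Prelaminates can be perturbed so that all points that occur are distinct: the perturbed one can
replace its starting point in any laminate whose other atoms belong to a given finite set. -/
theorem IsPrelaminate.exists_perturbation (hD : ∀ η ∈ D, ∀ c : ℝ, c ≠ 0 → c • η ∈ D) (h0 : 0 ∉ D)
    {ℓ : V →L[ℝ] ℝ} {d₀ : V} (hd₀ : d₀ ∈ D) (hℓd₀ : ℓ d₀ = 0) {t : ℝ} {U : Set V} (hU : IsOpen U)
    {E : Type*} [NormedAddCommGroup E] [NormedSpace ℝ E] {f : V → E} (hf : Continuous f)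
    {x : V} {p : V →₀ ℝ} (h : IsPrelaminate D (U ∩ {x | ℓ x = t}) x p) :
    ∀ ε > 0, ∃ δ > 0, ∀ x', ℓ x' = t → ‖x' - x‖ < δ → ∀ F : Finset V, x' ∉ F → ∃ p' : V →₀ ℝ,
      linearCombination ℝ id p' = x' ∧
      ‖linearCombination ℝ f p' - linearCombination ℝ f p‖ ≤ ε ∧ Disjoint p'.support F ∧
      ∀ q : V →₀ ℝ, q.support ⊆ F → ∀ w > 0,
        IsAtomicLaminate D (U ∩ {x | ℓ x = t}) (q + Finsupp.single x' w) →
        IsAtomicLaminate D (U ∩ {x | ℓ x = t}) (q + w • p') := by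
  classical
  induction h with
  | single x hx =>
    intro ε hε
    obtain ⟨δ, hδ, hfδ⟩ := Metric.continuous_iff.1 hf x ε hε
    refine ⟨δ, hδ, fun x' _ hx' F hF => ⟨Finsupp.single x' 1, by simp, ?_, ?_, ?_⟩⟩
    · have := hfδ x' (by rwa [dist_eq_norm])
      rw [dist_eq_norm] at this
      simpa using this.le
    · rw [Finsupp.support_single x' one_ne_zero]
      simpa using hF
    · intro q _ w _ h
      simpa using h
  | split x y p q s hs₀ hs₁ hseg hd hp hq ihp ihq =>
    intro ε hε
    obtain ⟨δ₁, hδ₁, h₁⟩ := ihp ε hε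
    obtain ⟨δ₂, hδ₂, h₂⟩ := ihq ε hε
    have hcomp : IsCompact (segment ℝ x y) := by
      rw [segment_eq_image]
      exact isCompact_Icc.image (by fun_prop)
    obtain ⟨δ₃, hδ₃, h₃⟩ := hcomp.exists_thickening_subset_open hU (fun z hz => (hseg hz).1)
    have hℓx : ℓ x = t := (hseg (left_mem_segment ℝ x y)).2
    have hℓy : ℓ y = t := (hseg (right_mem_segment ℝ x y)).2
    -- Starting point and direction each move by less than `δ`, so points of the segment move by
    -- less than `2 * δ`.
    set δ := min (min δ₁ δ₂) δ₃ / 2 with hδ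
    have hδpos : 0 < δ := by positivity
    have hle₁ : 2 * δ ≤ δ₁ := by
      rw [hδ]; linarith [min_le_left (min δ₁ δ₂) δ₃, min_le_left δ₁ δ₂]
    have hle₂ : 2 * δ ≤ δ₂ := by
      rw [hδ]; linarith [min_le_left (min δ₁ δ₂) δ₃, min_le_right δ₁ δ₂]
    have hle₃ : 2 * δ ≤ δ₃ := by
      rw [hδ]; linarith [min_le_right (min δ₁ δ₂) δ₃]
    refine ⟨δ, hδpos, fun x' hℓx' hx' F hF => ?_⟩
    obtain ⟨e, heD, hℓe, hed, heF₁, heF₂⟩ := exists_direction_avoiding hD h0 hd₀ hℓd₀ hd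
      (by rw [map_sub, hℓx, hℓy, sub_self]) hδpos hs₀ hs₁ x' F
    have hnear : ∀ a : ℝ, |a| ≤ 1 →
        ‖(x' + a • e) - (s • x + (1 - s) • y + a • (x - y))‖ < 2 * δ := by
      intro a ha
      calc ‖(x' + a • e) - (s • x + (1 - s) • y + a • (x - y))‖
          = ‖(x' - (s • x + (1 - s) • y)) + a • (e - (x - y))‖ := by congr 1; module
        _ ≤ ‖x' - (s • x + (1 - s) • y)‖ + |a| * ‖e - (x - y)‖ := by
          refine (norm_add_le _ _).trans ?_
          rw [norm_smul, Real.norm_eq_abs]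
        _ < δ + δ := by
          refine add_lt_add hx' (lt_of_le_of_lt ?_ hed)
          exact mul_le_of_le_one_left (norm_nonneg _) ha
        _ = 2 * δ := by ring
    have hline : ∀ a b : ℝ, a + b = 1 → a • (x' + (1 - s) • e) + b • (x' - s • e)
        = x' + (a - s) • e := by
      intro a b hab
      obtain rfl : b = 1 - a := by linarith
      module
    set y₁ := x' + (1 - s) • e with hy₁
    set y₂ := x' - s • e with hy₂
    have hsum : s • y₁ + (1 - s) • y₂ = x' := by
      rw [hline s (1 - s) (by ring)]; simp
    have hsub : y₁ - y₂ = e := by rw [hy₁, hy₂]; module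
    have hne : y₁ ≠ y₂ := fun h => h0 (by rw [← sub_eq_zero, hsub] at h; exact h ▸ heD)
    have hseg' : segment ℝ y₁ y₂ ⊆ U ∩ {x | ℓ x = t} := by
      rintro _ ⟨a, b, ha, hb, hab, rfl⟩
      rw [hline a b hab]
      refine ⟨h₃ (Metric.mem_thickening_iff.2 ⟨_, ⟨a, b, ha, hb, hab, rfl⟩, ?_⟩), by
        simp [hℓx', hℓe]⟩
      rw [dist_eq_norm]
      have hb' : b = 1 - a := by linarith
      have := hnear (a - s) (abs_le.2 ⟨by linarith, by linarith⟩)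
      refine lt_of_eq_of_lt ?_ (this.trans_le hle₃)
      rw [hb']
      congr 1
      module
    -- The first branch must also avoid `y₂`, which is still an atom while `y₁` is being replaced;
    -- the second then avoids the atoms of `p₁`.
    obtain ⟨p₁, hp₁b, hp₁f, hp₁F, hp₁⟩ := h₁ y₁ (by simp [hy₁, hℓx', hℓe]) (by
      have := hnear (1 - s) (abs_le.2 ⟨by linarith, by linarith⟩)
      refine lt_of_eq_of_lt ?_ (this.trans_le hle₁)
      rw [hy₁]; congr 1; module) (insert y₂ F) (by
        rw [Finset.mem_insert, not_or]; exact ⟨hne, heF₁⟩)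
    rw [Finset.disjoint_insert_right] at hp₁F
    obtain ⟨p₂, hp₂b, hp₂f, hp₂F, hp₂⟩ := h₂ y₂ (by simp [hy₂, hℓx', hℓe]) (by
      have := hnear (-s) (abs_le.2 ⟨by linarith, by linarith⟩)
      refine lt_of_eq_of_lt ?_ (this.trans_le hle₂)
      rw [hy₂]; congr 1; module) (F ∪ p₁.support) (by
        rw [Finset.mem_union, not_or]; exact ⟨heF₂, hp₁F.1⟩)
    refine ⟨s • p₁ + (1 - s) • p₂, ?_, ?_, ?_, ?_⟩
    · rw [map_add, map_smul, map_smul, hp₁b, hp₂b, hsum]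
    · simp only [map_add, map_smul]
      calc _ = ‖s • (linearCombination ℝ f p₁ - linearCombination ℝ f p)
            + (1 - s) • (linearCombination ℝ f p₂ - linearCombination ℝ f q)‖ := by
              congr 1; module
        _ ≤ s * ε + (1 - s) * ε := by
          refine (norm_add_le _ _).trans ?_
          rw [norm_smul, norm_smul, Real.norm_of_nonneg hs₀.le,
            Real.norm_of_nonneg (by linarith : 0 ≤ 1 - s)]
          have := sub_pos.2 hs₁
          gcongr
        _ = ε := by ring
    · rw [Finset.disjoint_union_right] at hp₂F
      refine Disjoint.mono_left Finsupp.support_add (Finset.disjoint_union_left.2 ⟨?_, ?_⟩)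
      · exact hp₁F.2.mono_left Finsupp.support_smul
      · exact hp₂F.1.mono_left Finsupp.support_smul
    -- Split `x'` into `y₁` and `y₂`, replace `y₁` by `p₁`, then `y₂` by `p₂`.
    · intro r hr w hw hr'
      have hsplit := IsAtomicLaminate.split r x' y₁ y₂ w hw s hs₀ hs₁ hsum (fun h => hF (hr h)) hr'
        hseg' (hsub ▸ heD) (fun h => heF₁ (hr h)) (fun h => heF₂ (hr h))
      have hstep₁ := hp₁ (r + Finsupp.single y₂ (w * (1 - s))) (by
        refine Finsupp.support_add.trans (Finset.union_subset ?_ ?_)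
        · exact hr.trans (Finset.subset_insert _ _)
        · exact Finsupp.support_single_subset.trans (by simp)) (w * s) (by positivity)
        (by rwa [add_right_comm])
      have hstep₂ := hp₂ (r + (w * s) • p₁) (by
        refine Finsupp.support_add.trans (Finset.union_subset ?_ ?_)
        · exact hr.trans Finset.subset_union_left
        · exact Finsupp.support_smul.trans Finset.subset_union_right) (w * (1 - s))
        (mul_pos hw (sub_pos.2 hs₁)) (by rwa [add_right_comm])
      convert hstep₂ using 1
      rw [smul_add, smul_smul, smul_smul, add_assoc]

/-- Every prelaminate is approximated by laminates with distinct atoms and the same barycenter. -/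
theorem IsPrelaminate.exists_isAtomicLaminate (hD : ∀ η ∈ D, ∀ c : ℝ, c ≠ 0 → c • η ∈ D)
    (h0 : 0 ∉ D) {ℓ : V →L[ℝ] ℝ} {d₀ : V} (hd₀ : d₀ ∈ D) (hℓd₀ : ℓ d₀ = 0) {t : ℝ} {U : Set V}
    (hU : IsOpen U) {E : Type*} [NormedAddCommGroup E] [NormedSpace ℝ E] {f : V → E}
    (hf : Continuous f) {x : V} (hx : x ∈ U ∩ {x | ℓ x = t}) {p : V →₀ ℝ}
    (h : IsPrelaminate D (U ∩ {x | ℓ x = t}) x p) {ε : ℝ} (hε : 0 < ε) :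
    ∃ p', IsAtomicLaminate D (U ∩ {x | ℓ x = t}) p' ∧ linearCombination ℝ id p' = x ∧
      ‖linearCombination ℝ f p' - linearCombination ℝ f p‖ ≤ ε := by
  obtain ⟨δ, hδ, H⟩ := h.exists_perturbation hD h0 hd₀ hℓd₀ hU hf ε hε
  obtain ⟨p', h1, h2, -, h3⟩ := H x hx.2 (by simpa using hδ) ∅ (by simp)
  refine ⟨p', ?_, h1, h2⟩
  have := h3 0 (by simp) 1 one_pos (by simpa using .single x hx)
  simpa using this

end Approximation

/-! ### Weights of laminates with distinct atoms -/

section AtomicLaminate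

variable {V : Type*} [AddCommGroup V] [Module ℝ V] {D O : Set V}

theorem IsAtomicLaminate.pos_and_mem (h0 : 0 ∉ D) {p : V →₀ ℝ} (h : IsAtomicLaminate D O p) :
    ∀ u ∈ p.support, 0 < p u ∧ u ∈ O := by
  classical
  induction h with
  | single x hx =>
    intro u hu
    obtain rfl : u = x := by
      rw [Finsupp.support_single x one_ne_zero] at hu; simpa using hu
    simpa using hx
  | split q x y z w hw s hs₀ hs₁ hx hxq hq hseg hd hyq hzq ih =>
    have hyz : y ≠ z := fun h => h0 (by rwa [h, sub_self] at hd)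
    have hy0 : q y = 0 := Finsupp.notMem_support_iff.1 hyq
    have hz0 : q z = 0 := Finsupp.notMem_support_iff.1 hzq
    intro u hu
    by_cases huy : u = y
    · subst huy
      refine ⟨?_, hseg (left_mem_segment ℝ u z)⟩
      simp only [Finsupp.add_apply, hy0, Finsupp.single_eq_same, Finsupp.single_eq_of_ne hyz]
      simpa using mul_pos hw hs₀
    by_cases huz : u = z
    · subst huz
      refine ⟨?_, hseg (right_mem_segment ℝ y u)⟩
      simp only [Finsupp.add_apply, hz0, Finsupp.single_eq_same, Finsupp.single_eq_of_ne huy]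
      simpa using mul_pos hw (sub_pos.2 hs₁)
    have hpu : (q + Finsupp.single y (w * s) + Finsupp.single z (w * (1 - s))) u = q u := by
      simp [Finsupp.single_eq_of_ne huy, Finsupp.single_eq_of_ne huz]
    have hqu : q u ≠ 0 := by rwa [Finsupp.mem_support_iff, hpu] at hu
    have hux : u ≠ x := fun h => hxq (h ▸ Finsupp.mem_support_iff.2 hqu)
    have hqx : (q + Finsupp.single x w) u = q u := by simp [Finsupp.single_eq_of_ne hux]
    rw [hpu]
    have := ih u (by rw [Finsupp.mem_support_iff, hqx]; exact hqu)
    rwa [hqx] at this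

theorem IsAtomicLaminate.sum_eq_one {p : V →₀ ℝ} (h : IsAtomicLaminate D O p) :
    linearCombination ℝ (fun _ => (1 : ℝ)) p = 1 := by
  induction h with
  | single x hx => simp
  | split q x y z w hw s hs₀ hs₁ hx hxq hq hseg hd hyq hzq ih =>
    simp only [map_add, linearCombination_single, smul_eq_mul, mul_one] at ih ⊢
    linear_combination ih

theorem IsAtomicLaminate.abs_linearCombination_le (h0 : 0 ∉ D) {p : V →₀ ℝ}
    (h : IsAtomicLaminate D O p) {g : V → ℝ} {c : ℝ} (hg : ∀ y ∈ O, |g y| ≤ c) :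
    |linearCombination ℝ g p| ≤ c := by
  have hp := h.pos_and_mem h0
  rw [linearCombination_apply, Finsupp.sum]
  calc |∑ y ∈ p.support, p y • g y| ≤ ∑ y ∈ p.support, |p y • g y| :=
        Finset.abs_sum_le_sum_abs _ _
    _ ≤ ∑ y ∈ p.support, p y * c := by
        refine Finset.sum_le_sum fun y hy => ?_
        rw [smul_eq_mul, abs_mul, abs_of_pos (hp y hy).1]
        exact mul_le_mul_of_nonneg_left (hg y (hp y hy).2) (hp y hy).1.le
    _ = c := by
        have := h.sum_eq_one
        rw [linearCombination_apply, Finsupp.sum] at this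
        simp only [smul_eq_mul, mul_one] at this
        rw [← Finset.sum_mul, this, one_mul]

end AtomicLaminate

/-! ### Density of finite splittings by separation -/

section Density

variable {V : Type*} [NormedAddCommGroup V] [NormedSpace ℝ V] [FiniteDimensional ℝ V]
  [MeasurableSpace V] [BorelSpace V] {D : Set V}

omit [NormedSpace ℝ V] [FiniteDimensional ℝ V] in
theorem integrable_of_continuous_of_ae_mem {E : Type*} [NormedAddCommGroup E]
    {ν : Measure V} [IsProbabilityMeasure ν] {K : Set V} (hK : IsCompact K) (hνK : ∀ᵐ x ∂ν, x ∈ K)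
    {f : V → E} (hf : Continuous f) : Integrable f ν := by
  have := hf.continuousOn.integrableOn_compact hK (μ := ν)
  rwa [IntegrableOn, Measure.restrict_eq_self_of_ae_mem hνK] at this

omit [FiniteDimensional ℝ V] [BorelSpace V] in
theorem mem_dirHull_of_jensen {ν : Measure V} {K : Set V}
    (hνK : ∀ᵐ x ∂ν, x ∈ K) {x : V}
    (hJ : ∀ G : V → ℝ, DirConvexOn D univ G → G x ≤ ∫ y, G y ∂ν) : x ∈ dirHull D K :=
  fun G hG hGK => (hJ G hG).trans
    (integral_nonpos_of_ae (by filter_upwards [hνK] with y hy using hGK y hy))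

/-- Separation argument: measures satisfying Jensen's inequality for all functions that are convex in
the directions of `D` are limits of prelaminates. -/
theorem exists_isPrelaminate_near (hD : ∀ η ∈ D, ∀ c : ℝ, c ≠ 0 → c • η ∈ D)
    (hcl : IsClosed (insert 0 D)) (hspan : Submodule.span ℝ D = ⊤)
    {ℓ : V →L[ℝ] ℝ} (hℓ : ℓ ≠ 0)
    (hspanℓ : LinearMap.ker (ℓ : V →ₗ[ℝ] ℝ) ≤
      Submodule.span ℝ (D ∩ (LinearMap.ker (ℓ : V →ₗ[ℝ] ℝ) : Set V))) {t : ℝ}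
    {K U : Set V} (hK : IsCompact K) (hU : IsOpen U) (hUb : Bornology.IsBounded U)
    (hKU : dirHull D K ⊆ U ∩ {x | ℓ x = t}) {ν : Measure V} [IsProbabilityMeasure ν]
    (hνK : ∀ᵐ x ∂ν, x ∈ K) {x : V} (hJ : ∀ G : V → ℝ, DirConvexOn D univ G → G x ≤ ∫ y, G y ∂ν)
    {E : Type*} [NormedAddCommGroup E] [NormedSpace ℝ E] [CompleteSpace E] {f : V → E}
    (hf : Continuous f) {ε : ℝ} (hε : 0 < ε) :
    ∃ p, IsPrelaminate D (U ∩ {x | ℓ x = t}) x p ∧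
      ‖linearCombination ℝ f p - ∫ y, f y ∂ν‖ < ε := by
  have := FiniteDimensional.proper ℝ V
  have hxQ : x ∈ dirHull D K := mem_dirHull_of_jensen hνK hJ
  set O := U ∩ {x | ℓ x = t} with hO
  have hxO : x ∈ O := hKU hxQ
  set A : Set E := linearCombination ℝ f '' {p | IsPrelaminate D O x p} with hA
  have hAconv : Convex ℝ (closure A) :=
    ((convex_setOf_isPrelaminate hxO).linear_image _).closure
  have hmem : ∫ y, f y ∂ν ∈ closure A := by
    by_contra hn
    -- The separating functional turns the vector-valued `f` into one scalar test function `g`.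
    obtain ⟨a, u, hau, hua⟩ := geometric_hahn_banach_point_closed hAconv isClosed_closure hn
    set g : V → ℝ := fun y => a (f y) with hg
    have hgc : Continuous g := a.continuous.comp hf
    have hgi : ∫ y, g y ∂ν < u := by
      rw [hg, a.integral_comp_comm (integrable_of_continuous_of_ae_mem hK hνK hf)]
      exact hau
    obtain ⟨c, hc⟩ := (hUb.isCompact_closure.image hgc).bddBelow
    have hcO : ∀ y ∈ O, c ≤ g y := fun y hy =>
      hc (mem_image_of_mem g (subset_closure hy.1))
    have hu : u ≤ dirEnvelope D O g x := by
      refine le_dirEnvelope hxO fun p hp => ?_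
      have h1 := hua _ (subset_closure (mem_image_of_mem _ hp))
      rw [linearCombination_apply, Finsupp.sum, map_sum] at h1
      rw [linearCombination_apply, Finsupp.sum]
      simpa [hg] using h1.le
    -- Extension costs `τ` at `x` and `τ` under the integral: `u ≤ G x + τ ≤ ∫ G + τ ≤ ∫ g + 2 * τ <
    -- u`.
    set τ := (u - ∫ y, g y ∂ν) / 3 with hτ
    have hτ0 : 0 < τ := by rw [hτ]; linarith
    obtain ⟨G, hG, hGf⟩ := (dirConvexOn_dirEnvelope (D := D) hcO).exists_extension hD hcl hspan hℓ
      hspanℓ hK hU hKU hτ0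
    have hGc := hG.continuous hD hspan
    have h1 : ∫ y, G y ∂ν ≤ ∫ y, (g y + τ) ∂ν := by
      refine integral_mono_ae (integrable_of_continuous_of_ae_mem hK hνK hGc)
        (integrable_of_continuous_of_ae_mem hK hνK (hgc.add continuous_const)) ?_
      filter_upwards [hνK] with y hy
      have hyQ := subset_dirHull D K hy
      have h2 := dirEnvelope_le_self (D := D) hcO (hKU hyQ)
      have h3 := (abs_le.1 (hGf y hyQ)).2
      linarith
    rw [integral_add (integrable_of_continuous_of_ae_mem hK hνK hgc) (integrable_const _)] at h1
    simp only [integral_const, probReal_univ, one_smul] at h1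
    have h2 := hJ G hG
    have h3 := (abs_le.1 (hGf x hxQ)).1
    linarith
  obtain ⟨_, ⟨p, hp, rfl⟩, h⟩ := Metric.mem_closure_iff.1 hmem ε hε
  exact ⟨p, hp, by rwa [dist_comm, dist_eq_norm] at h⟩

/-- `C(V, ℝ)` is separable for uniform convergence on compact sets. The `j`-th laminate is nearly
correct on the first `j + 1` members of a dense sequence, treated as one vector-valued function. As
all atoms lie in a fixed ball, this passes to every continuous function. -/
theorem exists_seq_isAtomicLaminate (hD : ∀ η ∈ D, ∀ c : ℝ, c ≠ 0 → c • η ∈ D) (h0 : 0 ∉ D)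
    (hcl : IsClosed (insert 0 D)) (hspan : Submodule.span ℝ D = ⊤)
    {ℓ : V →L[ℝ] ℝ} (hℓ : ℓ ≠ 0)
    (hspanℓ : LinearMap.ker (ℓ : V →ₗ[ℝ] ℝ) ≤
      Submodule.span ℝ (D ∩ (LinearMap.ker (ℓ : V →ₗ[ℝ] ℝ) : Set V)))
    {d₀ : V} (hd₀ : d₀ ∈ D) (hℓd₀ : ℓ d₀ = 0) {t : ℝ}
    {K U : Set V} (hK : IsCompact K) (hU : IsOpen U) (hKU : dirHull D K ⊆ U ∩ {x | ℓ x = t})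
    {ν : Measure V} [IsProbabilityMeasure ν] (hνK : ∀ᵐ x ∂ν, x ∈ K) {x : V}
    (hJ : ∀ G : V → ℝ, DirConvexOn D univ G → G x ≤ ∫ y, G y ∂ν) :
    ∃ p : ℕ → V →₀ ℝ, (∀ j, IsAtomicLaminate D (U ∩ {x | ℓ x = t}) (p j)) ∧
      (∀ j, linearCombination ℝ id (p j) = x) ∧
      ∀ f : V → ℝ, Continuous f →
        Tendsto (fun j => linearCombination ℝ f (p j)) atTop (𝓝 (∫ y, f y ∂ν)) := by
  have := FiniteDimensional.proper ℝ V
  obtain ⟨R, hR⟩ := (isCompact_dirHull hD hspan hK).isBounded.subset_ball (0 : V)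
  set U' := U ∩ Metric.ball 0 R
  have hU' : IsOpen U' := hU.inter Metric.isOpen_ball
  have hKU' : dirHull D K ⊆ U' ∩ {x | ℓ x = t} := fun y hy =>
    ⟨⟨(hKU hy).1, hR hy⟩, (hKU hy).2⟩
  have hxO := hKU' (mem_dirHull_of_jensen hνK hJ)
  let Φ : ℕ → C(V, ℝ) := TopologicalSpace.denseSeq C(V, ℝ)
  have hstep : ∀ j : ℕ, ∃ p, IsAtomicLaminate D (U' ∩ {x | ℓ x = t}) p ∧
      linearCombination ℝ id p = x ∧
      ∀ i ≤ j, |linearCombination ℝ (Φ i) p - ∫ y, Φ i y ∂ν| ≤ 2 * (1 / ((j : ℝ) + 1)) := by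
    intro j
    set ε : ℝ := 1 / ((j : ℝ) + 1)
    have hε : 0 < ε := by positivity
    set f : V → (Fin (j + 1) → ℝ) := fun y i => Φ i y with hf
    have hfc : Continuous f := by fun_prop
    obtain ⟨p, hp, hpf⟩ := exists_isPrelaminate_near hD hcl hspan hℓ hspanℓ hK hU'
      (Metric.isBounded_ball.subset inter_subset_right) hKU' hνK hJ hfc hε
    obtain ⟨p', hp', hb, hp'f⟩ := hp.exists_isAtomicLaminate hD h0 hd₀ hℓd₀ hU' hfc hxO hε
    refine ⟨p', hp', hb, fun i hi => ?_⟩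
    have h1 : ‖linearCombination ℝ f p' - ∫ y, f y ∂ν‖ ≤ 2 * ε := by
      calc _ ≤ _ := norm_sub_le_norm_sub_add_norm_sub _ (linearCombination ℝ f p) _
        _ ≤ ε + ε := add_le_add hp'f hpf.le
        _ = 2 * ε := by ring
    have h2 := (norm_le_pi_norm _ (⟨i, by omega⟩ : Fin (j + 1))).trans h1
    have h3 : (∫ y, f y ∂ν) (⟨i, by omega⟩ : Fin (j + 1)) = ∫ y, Φ i y ∂ν :=
      eval_integral (E := fun _ => ℝ)
        (fun i => integrable_of_continuous_of_ae_mem hK hνK (by fun_prop)) _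
    rw [Pi.sub_apply, h3, linearCombination_apply, Finsupp.sum, Finset.sum_apply, Real.norm_eq_abs] at h2
    rw [linearCombination_apply, Finsupp.sum]
    simpa [hf] using h2
  choose p hp hb hpf using hstep
  refine ⟨p, fun j => (hp j).mono (inter_subset_inter_left _ inter_subset_left), hb, ?_⟩
  intro f hf
  rw [Metric.tendsto_atTop]
  intro ε hε
  have hnear : ∀ᶠ g : C(V, ℝ) in 𝓝 (⟨f, hf⟩ : C(V, ℝ)), ∀ y ∈ Metric.closedBall (0 : V) R,
      dist (f y) (g y) < ε / 4 := by
    have := ContinuousMap.tendsto_iff_forall_isCompact_tendstoUniformlyOn.1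
      (tendsto_id (x := 𝓝 (⟨f, hf⟩ : C(V, ℝ)))) _ (isCompact_closedBall (0 : V) R)
    exact Metric.tendstoUniformlyOn_iff.1 this _ (by positivity)
  obtain ⟨i, hi⟩ := (TopologicalSpace.denseRange_denseSeq C(V, ℝ)).mem_nhds hnear
  -- Makes `2 / (j + 1) < ε / 4` for `j ≥ N`; the other two errors are at most `ε / 4` each.
  obtain ⟨N, hN⟩ := exists_nat_gt (8 / ε)
  refine ⟨max N i, fun j hj => ?_⟩
  have hjN : (N : ℝ) ≤ j := by exact_mod_cast (le_max_left _ _).trans hj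
  have hji : i ≤ j := (le_max_right _ _).trans hj
  have h1 := hpf j i hji
  have h2 : 2 * (1 / ((j : ℝ) + 1)) < ε / 4 := by
    rw [div_lt_iff₀ hε] at hN
    rw [mul_one_div, div_lt_iff₀ (by positivity)]
    nlinarith
  have h3 : |linearCombination ℝ (fun y => f y - Φ i y) (p j)| ≤ ε / 4 := by
    refine (hp j).abs_linearCombination_le h0 fun y hy => ?_
    have := hi y (Metric.ball_subset_closedBall hy.1.2)
    rw [Real.dist_eq] at this
    exact this.le
  have h4 : linearCombination ℝ (fun y => f y - Φ i y) (p j)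
      = linearCombination ℝ f (p j) - linearCombination ℝ (Φ i) (p j) := by
    simp only [linearCombination_apply, Finsupp.sum, smul_eq_mul, mul_sub, Finset.sum_sub_distrib]
  have hfi := integrable_of_continuous_of_ae_mem hK hνK hf
  have hΦi := integrable_of_continuous_of_ae_mem hK hνK (Φ i).continuous
  have h5 : |∫ y, Φ i y ∂ν - ∫ y, f y ∂ν| ≤ ε / 4 := by
    rw [← integral_sub hΦi hfi]
    have := norm_integral_le_of_norm_le_const (μ := ν) (f := fun y => Φ i y - f y) (C := ε / 4) (by
      filter_upwards [hνK] with y hy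
      have := hi y (Metric.ball_subset_closedBall (hR (subset_dirHull D K hy)))
      rw [dist_comm, Real.dist_eq] at this
      exact this.le)
    simpa using this
  rw [h4] at h3
  rw [Real.dist_eq]
  calc |linearCombination ℝ f (p j) - ∫ y, f y ∂ν|
      = |(linearCombination ℝ f (p j) - linearCombination ℝ (Φ i) (p j))
        + (linearCombination ℝ (Φ i) (p j) - ∫ y, Φ i y ∂ν)
        + (∫ y, Φ i y ∂ν - ∫ y, f y ∂ν)| := by congr 1; ring
    _ ≤ _ := abs_add_three _ _ _
    _ < ε := by linarith

end Density

/-! ### The cone of rank-one matrices -/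

section RankOne

variable {m n : ℕ}

theorem rank_eq_one_iff_vecMulVec (η : Mat m n) :
    η.rank = 1 ↔ η ≠ 0 ∧ ∃ a b, η = Matrix.vecMulVec a b := by
  constructor
  · intro h
    refine ⟨by rintro rfl; simp at h, ?_⟩
    obtain ⟨v, -, hv⟩ := finrank_eq_one_iff'.1 h
    have hcol : ∀ j, ∃ c : ℝ, ∀ i, c * (v : Fin m → ℝ) i = η i j := fun j => by
      obtain ⟨c, hc⟩ := hv ⟨η.mulVecLin (Pi.single j 1), LinearMap.mem_range_self _ _⟩
      refine ⟨c, fun i => ?_⟩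
      have := congrFun (congrArg Subtype.val hc) i
      simpa using this
    choose c hc using hcol
    refine ⟨v, c, ?_⟩
    ext i j
    rw [Matrix.vecMulVec_apply, ← hc j i, mul_comm]
  · rintro ⟨h0, a, b, rfl⟩
    refine le_antisymm (Matrix.rank_vecMulVec_le a b) (Nat.one_le_iff_ne_zero.2 fun h => h0 ?_)
    have h1 : LinearMap.range (Matrix.vecMulVec a b).mulVecLin = ⊥ := Submodule.finrank_eq_zero.1 h
    rw [LinearMap.range_eq_bot] at h1
    refine Matrix.mulVec_injective (funext fun v => ?_)
    simpa using LinearMap.congr_fun h1 v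

theorem rank_smul_eq_one {η : Mat m n} (h : η.rank = 1) {c : ℝ} (hc : c ≠ 0) :
    (c • η).rank = 1 := by
  rw [rank_eq_one_iff_vecMulVec] at h ⊢
  obtain ⟨h0, a, b, rfl⟩ := h
  exact ⟨smul_ne_zero hc h0, c • a, b, by rw [Matrix.smul_vecMulVec]⟩

/-- Rank at most one means that all `2 × 2` minors vanish, a closed condition. -/
theorem insert_zero_rank_eq_one : insert 0 {η : Mat m n | η.rank = 1} =
    {η | ∀ i j k l, η i j * η k l = η i l * η k j} := by
  ext η
  rw [mem_insert_iff, mem_ofPred_eq, mem_ofPred_eq, rank_eq_one_iff_vecMulVec]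
  constructor
  · rintro (rfl | ⟨-, a, b, rfl⟩) i j k l
    · simp
    · simp only [Matrix.vecMulVec_apply]; ring
  · intro h
    by_cases h0 : η = 0
    · exact Or.inl h0
    obtain ⟨k, l, hkl⟩ : ∃ k l, η k l ≠ 0 := by
      by_contra! H; exact h0 (Matrix.ext H)
    refine Or.inr ⟨h0, fun i => η i l, fun j => η k j / η k l, ?_⟩
    ext i j
    rw [Matrix.vecMulVec_apply, mul_div_assoc', eq_div_iff hkl, h]

theorem isClosed_insert_zero_rank_eq_one :
    IsClosed (insert 0 {η : Mat m n | η.rank = 1}) := by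
  rw [insert_zero_rank_eq_one]
  simp only [ofPred_forall]
  refine isClosed_iInter fun i => isClosed_iInter fun j => isClosed_iInter fun k =>
    isClosed_iInter fun l => isClosed_eq ?_ ?_ <;> fun_prop

theorem rank_single (i : Fin m) (j : Fin n) : (Matrix.single i j (1 : ℝ)).rank = 1 := by
  rw [rank_eq_one_iff_vecMulVec]
  refine ⟨fun h => ?_, _, _, Matrix.single_eq_single_vecMulVec_single i j⟩
  simpa using congrFun (congrFun h i) j

theorem span_rank_eq_one : Submodule.span ℝ {η : Mat m n | η.rank = 1} = ⊤ := by
  rw [eq_top_iff]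
  rintro η -
  rw [Matrix.matrix_eq_sum_single η]
  refine Submodule.sum_mem _ fun i _ => Submodule.sum_mem _ fun j _ => ?_
  rw [← mul_one (η i j), ← smul_eq_mul, ← Matrix.smul_single]
  exact Submodule.smul_mem _ _ (Submodule.subset_span (rank_single i j))

/-- The linear functional `ξ ↦ L · ξ`. -/
def linFunₗ (L : Mat m n) : Mat m n →ₗ[ℝ] ℝ where
  toFun := linFun L
  map_add' x y := by simp [linFun, mul_add, Finset.sum_add_distrib]
  map_smul' c x := by simp [linFun, Finset.mul_sum, mul_left_comm]

theorem linFunₗ_single (L : Mat m n) (i : Fin m) (j : Fin n) (c : ℝ) :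
    linFunₗ L (Matrix.single i j c) = L i j * c := by
  change ∑ i', ∑ j', L i' j' * Matrix.single i j c i' j' = _
  simp only [Matrix.single_apply, mul_ite, mul_zero, ite_and]
  simp

theorem linFunₗ_ne_zero {L : Mat m n} (hL : L ≠ 0) : linFunₗ L ≠ 0 := fun h =>
  hL (Matrix.ext fun i j => by simpa [h] using (linFunₗ_single L i j 1).symm)

/-- The rank-one matrices in the hyperplane orthogonal to `L` span it. -/
theorem ker_linFunₗ_le_span {L : Mat m n} (hL : L ≠ 0) : LinearMap.ker (linFunₗ L) ≤
    Submodule.span ℝ ({η : Mat m n | η.rank = 1} ∩ (LinearMap.ker (linFunₗ L) : Set (Mat m n))) := by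
  obtain ⟨p, q, hpq⟩ : ∃ p q, L p q ≠ 0 := by
    by_contra! H; exact hL (Matrix.ext H)
  set N := Submodule.span ℝ
    ({η : Mat m n | η.rank = 1} ∩ (LinearMap.ker (linFunₗ L) : Set (Mat m n))) with hN
  -- Normalized so that `c p q = 1`. The matrices `E i j - c i j • E p q` span the kernel, so it
  -- suffices to find them in `N`.
  set c : Fin m → Fin n → ℝ := fun i j => L i j / L p q with hc
  have hLc : ∀ i j, L i j = c i j * L p q := fun i j => by simp only [hc]; field_simp
  have hmem : ∀ a b, linFunₗ L (Matrix.vecMulVec a b) = 0 → Matrix.vecMulVec a b ∈ N := by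
    intro a b h
    by_cases h0 : Matrix.vecMulVec a b = 0
    · rw [h0]; exact N.zero_mem
    · exact Submodule.subset_span
        ⟨(rank_eq_one_iff_vecMulVec _).2 ⟨h0, a, b, rfl⟩, h⟩
  have hrow : ∀ j, Matrix.single p j (1 : ℝ) - c p j • Matrix.single p q 1 ∈ N := by
    intro j
    have h : Matrix.single p j (1 : ℝ) - c p j • Matrix.single p q 1
        = Matrix.vecMulVec (Pi.single p 1) (Pi.single j 1 - c p j • Pi.single q 1) := by
      rw [Matrix.vecMulVec_sub, Matrix.vecMulVec_smul, Matrix.single_eq_single_vecMulVec_single,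
        Matrix.single_eq_single_vecMulVec_single]
    rw [h]
    refine hmem _ _ ?_
    rw [← h, map_sub, map_smul, linFunₗ_single, linFunₗ_single, smul_eq_mul, hLc p j]
    ring
  have hcol : ∀ i, Matrix.single i q (1 : ℝ) - c i q • Matrix.single p q 1 ∈ N := by
    intro i
    have h : Matrix.single i q (1 : ℝ) - c i q • Matrix.single p q 1
        = Matrix.vecMulVec (Pi.single i 1 - c i q • Pi.single p 1) (Pi.single q 1) := by
      rw [Matrix.sub_vecMulVec, Matrix.smul_vecMulVec, Matrix.single_eq_single_vecMulVec_single,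
        Matrix.single_eq_single_vecMulVec_single]
    rw [h]
    refine hmem _ _ ?_
    rw [← h, map_sub, map_smul, linFunₗ_single, linFunₗ_single, smul_eq_mul, hLc i q]
    ring
  have hall : ∀ i j, Matrix.single i j (1 : ℝ) - c i j • Matrix.single p q 1 ∈ N := by
    intro i j
    -- `(e i + x e p) ⊗ (e j + y e q)` is tangent exactly when `y` solves a linear equation with
    -- leading coefficient `c i q + x`. Expanding it and removing the row and column terms already
    -- in `N` leaves the desired matrix.
    obtain ⟨x, hx⟩ : ∃ x : ℝ, c i q + x ≠ 0 := ⟨1 - c i q, by simp⟩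
    set y := -(c i j + x * c p j) / (c i q + x) with hy
    have hxy : c i j + y * c i q + x * c p j + x * y = 0 := by
      rw [hy]; field_simp; ring
    have h : Matrix.vecMulVec (Pi.single i 1 + x • Pi.single p 1)
        (Pi.single j 1 + y • Pi.single q 1) = Matrix.single i j (1 : ℝ) +
          y • Matrix.single i q 1 + x • Matrix.single p j 1 + (x * y) • Matrix.single p q 1 := by
      simp only [Matrix.vecMulVec_add, Matrix.vecMulVec_smul, Matrix.add_vecMulVec,
        Matrix.smul_vecMulVec, Matrix.single_eq_single_vecMulVec_single]
      module
    have h1 := hmem (Pi.single i 1 + x • Pi.single p 1) (Pi.single j 1 + y • Pi.single q 1) (by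
      rw [h]
      simp only [map_add, map_smul, linFunₗ_single, smul_eq_mul, hLc i j, hLc i q, hLc p j]
      linear_combination L p q * hxy)
    have h2 := N.sub_mem (N.sub_mem h1 (N.smul_mem y (hcol i))) (N.smul_mem x (hrow j))
    rw [h] at h2
    convert h2 using 1
    have hcij : c i j = -(y * c i q + x * c p j + x * y) := by linear_combination hxy
    rw [hcij]
    module
  intro ξ hξ
  have h0 : ∑ i, ∑ j, ξ i j * c i j = 0 := by
    have h1 : ∑ i, ∑ j, L i j * ξ i j = 0 := hξ
    have h2 : L p q * ∑ i, ∑ j, ξ i j * c i j = 0 := by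
      rw [← h1, Finset.mul_sum]
      refine Finset.sum_congr rfl fun i _ => ?_
      rw [Finset.mul_sum]
      refine Finset.sum_congr rfl fun j _ => ?_
      rw [hLc i j]; ring
    exact (mul_eq_zero.1 h2).resolve_left hpq
  have h1 : ξ = ∑ i, ∑ j, ξ i j • (Matrix.single i j (1 : ℝ) - c i j • Matrix.single p q 1) := by
    simp only [smul_sub, Finset.sum_sub_distrib, smul_smul, ← Finset.sum_smul, h0, zero_smul,
      sub_zero]
    conv_lhs => rw [Matrix.matrix_eq_sum_single ξ]
    simp [Matrix.smul_single]
  rw [h1]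
  exact N.sum_mem fun i _ => N.sum_mem fun j _ => N.smul_mem _ (hall i j)

/-- Matrices supported in one row have rank at most one, and a functional on a row of length at
least two has a nontrivial kernel. The matrix found serves to perturb trivial splittings. -/
theorem exists_rank_eq_one_linFunₗ_eq_zero (hm : 0 < m) (hn : 2 ≤ n) (L : Mat m n) :
    ∃ η : Mat m n, η.rank = 1 ∧ linFunₗ L η = 0 := by
  let p : Fin m := ⟨0, hm⟩
  let j₀ : Fin n := ⟨0, by omega⟩
  let j₁ : Fin n := ⟨1, by omega⟩
  have hj : j₀ ≠ j₁ := by simp [j₀, j₁]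
  by_cases h : L p j₀ = 0
  · exact ⟨Matrix.single p j₀ 1, rank_single _ _, by rw [linFunₗ_single, h, zero_mul]⟩
  refine ⟨Matrix.single p j₁ (L p j₀) - Matrix.single p j₀ (L p j₁), ?_, ?_⟩
  · rw [rank_eq_one_iff_vecMulVec]
    refine ⟨fun h' => h ?_, Pi.single p 1, Pi.single j₁ (L p j₀) - Pi.single j₀ (L p j₁), ?_⟩
    · simpa [hj] using congrFun (congrFun h' p) j₁
    · ext i j
      by_cases hi : i = p
      · subst hi
        simp [Matrix.vecMulVec_apply, Matrix.single_apply, Pi.single_apply, eq_comm]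
      · simp [Matrix.vecMulVec_apply, hi, Ne.symm hi]
  · rw [map_sub, linFunₗ_single, linFunₗ_single]; ring

end RankOne

/-! ### From weights to measures and laminates of finite order -/

section ToMeasure

variable {m n : ℕ} {O : Set (Mat m n)}

/-- The discrete measure with the given weights. -/
noncomputable def weightsMeasure (p : Mat m n →₀ ℝ) : Measure (Mat m n) :=
  p.sum fun x w => ENNReal.ofReal w • Measure.dirac x

theorem weightsMeasure_add_single {p : Mat m n →₀ ℝ} {x : Mat m n} (hx : x ∉ p.support) (w : ℝ) :
    weightsMeasure (p + Finsupp.single x w)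
      = weightsMeasure p + ENNReal.ofReal w • Measure.dirac x := by
  classical
  rw [weightsMeasure, Finsupp.sum_add_index_of_disjoint, Finsupp.sum_single_index (by simp)]
  · rfl
  · exact (Finset.disjoint_singleton_right.2 hx).mono_right Finsupp.support_single_subset

theorem card_support_add_single {V : Type*} {p : V →₀ ℝ} {x : V} (hx : x ∉ p.support) {w : ℝ}
    (hw : w ≠ 0) : (p + Finsupp.single x w).support.card = p.support.card + 1 := by
  classical
  rw [Finsupp.support_add_eq, Finset.card_union_of_disjoint]
  · rw [Finsupp.support_single x hw, Finset.card_singleton]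
  all_goals
    exact (Finset.disjoint_singleton_right.2 hx).mono_right Finsupp.support_single_subset

theorem discrete_equiv {p : Mat m n →₀ ℝ} {k : ℕ} (e : Fin k ≃ p.support) :
    discrete (fun j => p (e j)) (fun j => (e j : Mat m n)) = weightsMeasure p := by
  rw [discrete, weightsMeasure, Finsupp.sum, ← Finset.sum_coe_sort p.support]
  exact e.sum_comp fun x : p.support => ENNReal.ofReal (p x) • Measure.dirac (x : Mat m n)

theorem zero_notMem_rank_eq_one : (0 : Mat m n) ∉ {η : Mat m n | η.rank = 1} := by simp

/-- Order `k` goes with exactly `k + 1` atoms, so the count is carried along. The unsplit atoms are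
enumerated by `Fin k` and the atom to be split is appended last. -/
theorem IsAtomicLaminate.exists_isLaminateOfOrder {p : Mat m n →₀ ℝ}
    (h : IsAtomicLaminate {η : Mat m n | η.rank = 1} O p) :
    ∃ k, p.support.card = k + 1 ∧ IsLaminateOfOrder O k (weightsMeasure p) := by
  induction h with
  | single x hx =>
    refine ⟨0, by rw [Finsupp.support_single x one_ne_zero]; simp, ?_⟩
    rw [weightsMeasure, Finsupp.sum_single_index (by simp)]
    simpa using IsLaminateOfOrder.dirac x hx
  | split q x y z w hw s hs₀ hs₁ hx hxq hq hseg hd hyq hzq ih =>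
    have hyz : y ≠ z := fun h => zero_notMem_rank_eq_one (m := m) (n := n)
      (by rwa [h, sub_self] at hd)
    have hzq' : z ∉ (q + Finsupp.single y (w * s)).support := by
      rw [Finsupp.notMem_support_iff] at hzq ⊢
      simp [hzq, Finsupp.single_eq_of_ne hyz.symm]
    have hws := mul_pos hw hs₀
    have hws' := mul_pos hw (sub_pos.2 hs₁)
    obtain ⟨k, hk, hlam⟩ := ih
    rw [card_support_add_single hxq hw.ne', Nat.add_right_cancel_iff] at hk
    refine ⟨k + 1, by
      rw [card_support_add_single hzq' hws'.ne', card_support_add_single hyq hws.ne', hk], ?_⟩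
    rw [weightsMeasure_add_single hzq', weightsMeasure_add_single hyq]
    let e : Fin k ≃ q.support := (q.support.equivFinOfCardEq hk).symm
    have hprop := hq.pos_and_mem zero_notMem_rank_eq_one
    have hval : ∀ j, (q + Finsupp.single x w) (e j) = q (e j) := fun j => by
      have : (e j : Mat m n) ≠ x := fun h => hxq (h ▸ (e j).2)
      simp [Finsupp.single_eq_of_ne this]
    have hej : ∀ j, 0 < q (e j) ∧ (e j : Mat m n) ∈ O := fun j => by
      rw [← hval]
      refine hprop _ ?_
      rw [Finsupp.mem_support_iff, hval]
      exact Finsupp.mem_support_iff.1 (e j).2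
    have hxw : (q + Finsupp.single x w) x = w := by
      simp [Finsupp.notMem_support_iff.1 hxq]
    have hxO : x ∈ O := (hprop x (by rw [Finsupp.mem_support_iff, hxw]; exact hw.ne')).2
    let W : Fin (k + 1) → ℝ := Fin.snoc (α := fun _ => ℝ) (fun j => q (e j)) w
    let ξ : Fin (k + 1) → Mat m n := Fin.snoc (α := fun _ => Mat m n) (fun j => (e j : Mat m n)) x
    have hW1 : ∀ j : Fin k, W j.castSucc = q (e j) := fun j => Fin.snoc_castSucc ..
    have hW2 : W (Fin.last k) = w := Fin.snoc_last ..
    have hξ1 : ∀ j : Fin k, ξ j.castSucc = e j := fun j => Fin.snoc_castSucc ..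
    have hξ2 : ξ (Fin.last k) = x := Fin.snoc_last ..
    have hdisc : discrete W ξ = weightsMeasure (q + Finsupp.single x w) := by
      rw [weightsMeasure_add_single hxq, ← discrete_equiv e, discrete, Fin.sum_univ_castSucc]
      simp only [hW1, hW2, hξ1, hξ2, discrete]
    have hsum : ∑ j, W j = 1 := by
      have h1 := hq.sum_eq_one
      rw [map_add, linearCombination_single, linearCombination_apply, Finsupp.sum] at h1
      simp only [smul_eq_mul, mul_one] at h1
      rw [Fin.sum_univ_castSucc, hW2, ← h1, ← Finset.sum_coe_sort q.support,
        ← e.sum_comp fun u : q.support => q u]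
      simp only [hW1]
    have hfin := IsLaminateOfOrder.split k W ξ
      (Fin.lastCases (by rw [hW2]; exact hw) fun j => by rw [hW1]; exact (hej j).1) hsum
      (Fin.lastCases (by rw [hξ2]; exact hxO) fun j => by rw [hξ1]; exact (hej j).2)
      (Fin.snoc_injective_of_injective (Subtype.val_injective.comp e.injective) (by
        rintro ⟨j, hj⟩; exact hxq (hj ▸ (e j).2)))
      (by rw [hdisc]; exact hlam) s hs₀ hs₁ y z hseg hd (by rw [hξ2, hx])
      (fun j h => hyq (by rw [h, hξ1]; exact (e j).2))
      (fun j h => hzq (by rw [h, hξ1]; exact (e j).2))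
    simp only [hW1, hW2, hξ1, discrete_equiv e] at hfin
    rwa [mul_comm s, mul_comm (1 - s)] at hfin

theorem integral_weightsMeasure {p : Mat m n →₀ ℝ} (hp : ∀ x ∈ p.support, 0 < p x)
    (f : Mat m n → ℝ) : ∫ x, f x ∂weightsMeasure p = linearCombination ℝ f p := by
  rw [weightsMeasure, Finsupp.sum, integral_finsetSum_measure, linearCombination_apply, Finsupp.sum]
  · refine Finset.sum_congr rfl fun x hx => ?_
    rw [integral_smul_measure, integral_dirac, ENNReal.toReal_ofReal (hp x hx).le]
  · intro x _
    exact (integrable_dirac (by simp)).smul_measure ENNReal.ofReal_ne_top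

theorem barycenter_weightsMeasure {p : Mat m n →₀ ℝ} (hp : ∀ x ∈ p.support, 0 < p x) :
    barycenter (weightsMeasure p) = linearCombination ℝ id p := by
  ext i j
  rw [barycenter, Matrix.of_apply, integral_weightsMeasure hp, linearCombination_apply,
    linearCombination_apply, Finsupp.sum, Finsupp.sum, Matrix.sum_apply]
  rfl

/-- Subtracting a real constant strictly between `sup_K f` and `f ξ` normalizes `f`; such a constant
exists even for empty `K`, where the supremum is `-∞`. -/
theorem rcHull_eq_dirHull (K : Set (Mat m n)) : rcHull K = dirHull {η | η.rank = 1} K := by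
  ext ξ
  constructor
  · intro h f hf hK
    have h1 : (f ξ : EReal) ≤ ((0 : ℝ) : EReal) :=
      (h f hf).trans (iSup₂_le fun η hη => EReal.coe_le_coe_iff.2 (hK η hη))
    exact EReal.coe_le_coe_iff.1 h1
  · intro h f hf
    by_contra! hlt
    obtain ⟨c, hc, hcf⟩ := EReal.lt_iff_exists_real_btwn.1 hlt
    have h1 := h _ (DirConvexOn.add_const (D := {η : Mat m n | η.rank = 1}) hf (-c)) fun η hη => by
      have : (f η : EReal) < c := (le_iSup₂_of_le η hη le_rfl).trans_lt hc
      have := EReal.coe_lt_coe_iff.1 this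
      linarith
    have := EReal.coe_lt_coe_iff.1 hcf
    linarith

end ToMeasure

/-! ### The two assertions for matrices -/

section Matrix

attribute [local instance] Matrix.normedAddCommGroup Matrix.normedSpace

variable {m n : ℕ}

theorem rcHull_subset_hyperplane {L : Mat m n} {t : ℝ} {K : Set (Mat m n)}
    (hK : K ⊆ hyperplane L t) : rcHull K ⊆ hyperplane L t := by
  rw [rcHull_eq_dirHull]
  intro ξ hξ
  have hconv : ∀ a b : ℝ, DirConvexOn {η : Mat m n | η.rank = 1} univ
      fun x => a * linFunₗ L x + b := fun a b =>
    (dirConvexOn_of_convexOn ((a • linFunₗ L).convexOn convex_univ)).add_const b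
  have h1 := hξ _ (hconv 1 (-t)) fun η hη => by
    have : linFunₗ L η = t := hK hη
    simp [this]
  have h2 := hξ _ (hconv (-1) t) fun η hη => by
    have : linFunₗ L η = t := hK hη
    simp [this]
  change linFunₗ L ξ = t
  linarith

theorem rcHull_eq_rcHullIn {L : Mat m n} (hL : L ≠ 0) {t : ℝ} {K : Set (Mat m n)}
    (hK : IsCompact K) (hKt : K ⊆ hyperplane L t) : rcHull K = rcHullIn (hyperplane L t) K := by
  -- The Borel property is restated for the topology induced by the norm, which is definitionally
  -- the matrix topology.
  have : @BorelSpace (Mat m n) PseudoMetricSpace.toUniformSpace.toTopologicalSpace _ :=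
    instBorelSpaceMat m n
  apply Subset.antisymm
  · intro ξ hξ
    refine ⟨rcHull_subset_hyperplane hKt hξ, ?_⟩
    rintro ⟨f, hf, hfK, hfξ⟩
    let ℓ : Mat m n →L[ℝ] ℝ := LinearMap.toContinuousLinearMap (linFunₗ L)
    have hℓ : ℓ ≠ 0 := fun h => linFunₗ_ne_zero hL (LinearMap.ext fun x => DFunLike.congr_fun h x)
    rw [rcHull_eq_dirHull] at hξ
    -- With error `f ξ / 3`, the function `G - f ξ / 3` is nonpositive on `K` but still at least `f
    -- ξ / 3` at `ξ`.
    obtain ⟨G, hG, hGf⟩ := DirConvexOn.exists_extension (D := {η : Mat m n | η.rank = 1})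
      (fun η hη c hc => rank_smul_eq_one hη hc) isClosed_insert_zero_rank_eq_one span_rank_eq_one
      hℓ (ker_linFunₗ_le_span hL) (t := t) (K := K) (U := univ) hK isOpen_univ
      (by
        rw [univ_inter, ← rcHull_eq_dirHull]
        exact rcHull_subset_hyperplane hKt)
      (f := f) (by rw [univ_inter]; exact hf) (ε := f ξ / 3) (by positivity)
    have h1 := hξ _ (hG.add_const (-(f ξ / 3))) fun η hη => by
      have := (abs_le.1 (hGf η (subset_dirHull _ K hη))).2
      linarith [hfK η hη]
    have h2 := (abs_le.1 (hGf ξ hξ)).1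
    linarith
  · rintro ξ ⟨-, hξ⟩
    rw [rcHull_eq_dirHull]
    intro f hf hfK
    by_contra! hlt
    exact hξ ⟨f, hf.mono (subset_univ _), hfK, hlt⟩

theorem exists_seq_finiteLaminates (hm : 0 < m) (hn : 2 ≤ n) {L : Mat m n} (hL : L ≠ 0) {t : ℝ}
    {K : Set (Mat m n)} (hK : IsCompact K) {ν : Measure (Mat m n)} (hν : ν ∈ laminatesOn K)
    {O : Set (Mat m n)} (hO : IsOpenIn (hyperplane L t) O) (hKO : rcHull K ⊆ O) :
    ∃ νs : ℕ → Measure (Mat m n), (∀ j, νs j ∈ finiteLaminates O) ∧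
      (∀ j, barycenter (νs j) = barycenter ν) ∧
      ∀ f : Mat m n → ℝ, Continuous f →
        Tendsto (fun j => ∫ ξ, f ξ ∂(νs j)) atTop (𝓝 (∫ ξ, f ξ ∂ν)) := by
  have : @BorelSpace (Mat m n) PseudoMetricSpace.toUniformSpace.toTopologicalSpace _ :=
    instBorelSpaceMat m n
  have : SecondCountableTopology (Mat m n) :=
    inferInstanceAs (SecondCountableTopology (Fin m → Fin n → ℝ))
  obtain ⟨V, hV, rfl⟩ := hO
  obtain ⟨hνK, ⟨hprob, -⟩, hJ⟩ := hν
  let ℓ : Mat m n →L[ℝ] ℝ := LinearMap.toContinuousLinearMap (linFunₗ L)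
  have hℓ : ℓ ≠ 0 := fun h => linFunₗ_ne_zero hL (LinearMap.ext fun x => DFunLike.congr_fun h x)
  obtain ⟨d₀, hd₀, hLd₀⟩ := exists_rank_eq_one_linFunₗ_eq_zero hm hn L
  rw [rcHull_eq_dirHull] at hKO
  obtain ⟨p, hp, hb, hlim⟩ := exists_seq_isAtomicLaminate (D := {η : Mat m n | η.rank = 1})
    (fun η hη c hc => rank_smul_eq_one hη hc) zero_notMem_rank_eq_one
    isClosed_insert_zero_rank_eq_one span_rank_eq_one hℓ (ker_linFunₗ_le_span hL) hd₀ hLd₀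
    (t := t) hK hV hKO (ν := ν) (by
      filter_upwards [Measure.support_mem_ae (μ := ν)] with x hx using hνK hx)
    (x := barycenter ν) hJ
  have hpos : ∀ j, ∀ x ∈ (p j).support, 0 < p j x := fun j x hx =>
    ((hp j).pos_and_mem zero_notMem_rank_eq_one x hx).1
  refine ⟨fun j => weightsMeasure (p j), fun j => ?_, fun j => ?_, fun f hf => ?_⟩
  · obtain ⟨k, -, hk⟩ := (hp j).exists_isLaminateOfOrder
    exact ⟨k, hk⟩
  · rw [barycenter_weightsMeasure (hpos j), hb j]
  · simp only [integral_weightsMeasure (hpos _)]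
    exact hlim f hf

end Matrix

end RankOneHull

theorem theorem2p2 (m n : ℕ) (hm : 2 ≤ m) (hn : 2 ≤ n)
    (L : RankOneHull.Mat m n) (hL : L ≠ 0) (t : ℝ)
    (K : Set (RankOneHull.Mat m n)) (hK : IsCompact K)
    (hKt : K ⊆ RankOneHull.hyperplane L t) :
    RankOneHull.rcHull K = RankOneHull.rcHullIn (RankOneHull.hyperplane L t) K ∧
    ∀ ν ∈ RankOneHull.laminatesOn K, ∀ O : Set (RankOneHull.Mat m n),
      RankOneHull.IsOpenIn (RankOneHull.hyperplane L t) O → RankOneHull.rcHull K ⊆ O →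
      ∃ νs : ℕ → MeasureTheory.Measure (RankOneHull.Mat m n),
        (∀ j, νs j ∈ RankOneHull.finiteLaminates O) ∧
        (∀ j, RankOneHull.barycenter (νs j) = RankOneHull.barycenter ν) ∧
        ∀ f : RankOneHull.Mat m n → ℝ, Continuous f →
          Filter.Tendsto (fun j => ∫ ξ, f ξ ∂(νs j)) Filter.atTop (nhds (∫ ξ, f ξ ∂ν)) :=
  ⟨RankOneHull.rcHull_eq_rcHullIn hL hK hKt, fun _ hν _ hO hKO =>
    RankOneHull.exists_seq_finiteLaminates (by omega) hn hL hK hν hO hKO⟩
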